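/- **Setting.** A (tabular, finite-horizon) *action-constrained Markov game* $\overline G$ consists of players $1,\dots,n$, a horizon $H$, finite state sets $\mathcal S_1,\dots,\mathcal S_{H+1}$, a finite joint action set $\mathcal A=\mathcal A_1\times\cdots\times\mathcal A_n$, sets $\mathcal A_h(s)\subseteq\mathcal A$ of allowed joint actions (not necessarily products), and, for $h\le H$, $s\in\mathcal S_h$, $a\in\mathcal A_h(s)$, a distribution $P_h(\cdot\mid s,a)$ on $\mathcal S_{h+1}$ and real expected rewards $r_{i,h}(s,a)$. It is *feasible* if $\mathcal A_h(s)\ne\varnothing$ for all $h\le H$, $s\in\mathcal S_h$. Its size $|\overline G|$ is the number of entries of its tables (each real number counts as one entry). A Markovian joint policy $\pi$ is *feasible* if $\pi_h(s)\in\Delta(\mathcal A_h(s))$ for all $h\le H$, $s\in\mathcal S_h$; a history-dependent one, if $\pi_h(\tau_h)\in\Delta(\mathcal A_h(s_h))$ for all $h\le H$ and all histories $\tau_h=(s_1,a_1,\dots,s_h)$. Let $V^{\pi}_{i,h}$ denote player $i$'s expected sum of rewards from time $h$ to $H$, given the current state (for Markovian $\pi$) or history. A *deviation* of player $i$ from $\pi$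 is, for CCE, a history-dependent policy $\pi_i'$ of player $i$, resulting in the joint policy $\pi'=(\pi_i',\pi_{-i})$ in which player $i$ plays independently of the others' marginal $\pi_{-i}$; for CE, a (possibly randomized, history-dependent) strategy modification $\varphi$ of player $i$'s recommended action, resulting in $\pi'=\varphi\circ\pi$. A feasible Markovian $\pi$ is a *Markov-perfect equilibrium* (MPE) if for all players $i$, times $h$, histories $\tau_h$ and deviations, either $\pi'$ is not feasible or $V^{\pi}_{i,h}(s_h)\ge V^{\pi'}_{i,h}(\tau_h)$. It is an MPE *in the strong sense* if this holds even when $\pi'$ only has to be feasible at the histories that $\pi'$ reaches with positive probability from $\tau_h$ on. For an action-constrained matrix game $(\mathcal A,X,u)$ with $u_i(a)\in\mathbb R$ for $a\in X$ and $u_i(a)=-\infty$ for $a\notin X$, $\mathrm{CLP}(\mathcal A,X,u)$ asks for $\sigma\ge 0$ on $X$ (and $\sigma=0$ off $X$) with $\sum_{a\in X}\sigma(a)=1$ and $$\text{(CCE)}\quad \sum_{a\in X}\sigma(a)\bigl(u_i(a)-u_i(a_i',a_{-i})\bigr)\ge 0\qquad\forall i,\ a_i'\in\mathcal A_i,$$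 $$\text{(CE)}\quad \sum_{a\in X,\ a_i=b}\sigma(a)\bigl(u_i(a)-u_i(a_i',a_{-i})\bigr)\ge 0\qquad\forall i,\ b,a_i'\in\mathcal A_i,$$ where $x-(-\infty)=\infty$ and $0\cdot\infty=0$. The stage game of $\pi$ at $(h,s)$ has $X=\mathcal A_h(s)$ and $u_i(a)=r_{i,h}(s,a)+\sum_{s'}P_h(s'\mid s,a)V^{\pi}_{i,h+1}(s')$ for $a\in X$. The *constrained solver* goes through $h=H,\dots,1$ and all $s\in\mathcal S_h$, computes the stage game from the already computed values $V_{i,h+1}$, calls $\textsc{LPSolve}$ on its CLP, in which $-\infty$ is replaced by a real number smaller than all utilities of the stage game, takes the answer as $\pi_h(s)$, and sets $V_{i,h}(s)=\sum_{a\in\mathcal A_h(s)}\pi_h(a\mid s)u_i(a)$. $\textsc{LPSolve}$ is *correct* if on every finite system of linear inequalities over $\mathbb R$ it returns a solution if there is one, and otherwise reports that there is none. Running times are in the unit-cost model of real arithmetic: every arithmetic operation, comparison and bookkeeping step counts as one step, and a call of $\textsc{LPSolve}$ additionally costs the running time of $\textsc{LPSolve}$. $\textsc{LPSolve}$ runs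 in polynomial time if its running time is at most $q(\text{number of variables}+\text{number of coefficients})$ for a polynomial $q$. **Theorem (Constrained Solver).** Let the equilibrium concept be CE or CCE. 1. For every feasible action-constrained Markov game $\overline G$ and every policy $\pi$, the CLP of every stage game has a solution; and every policy $\pi$ such that $\pi_h(s)$ solves the CLP of the stage game of $\pi$ at $(h,s)$, for all $h\le H$ and $s\in\mathcal S_h$, is a feasible MPE, also in the strong sense. 2. There is a polynomial $p$ such that, for every correct $\textsc{LPSolve}$ and every feasible $\overline G$, the policy that the constrained solver outputs solves the CLP of each of its stage games and is a feasible MPE, also in the strong sense; moreover the constrained solver performs at most $p(|\overline G|)$ steps of its own and exactly $\sum_{h=1}^H|\mathcal S_h|$ calls of $\textsc{LPSolve}$, each on a system of size at most $p(|\overline G|)$. 3. For every polynomial $q$ there is a polynomial $p$ such that, if $\textsc{LPSolve}$ is correct and runs in time $q$, then on every feasible $\overline G$ the total running time of the constrained solver is at most $p(|\overline G|)$. -/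

import Mathlib

/-! ### Action-constrained Markov games -/

/-- The tables describing a tabular finite-horizon action-constrained Markov game whose numbers
are of type `R`. Players are `0, …, n - 1`, decision times are `0, …, H - 1` and the interaction
ends in a state of time `H`. State spaces and the sets of allowed joint actions depend on time, and
the allowed set need not be a product. Entries at times that do not occur play no role. -/
structure ACGame (R : Type) where
  n : ℕ
  H : ℕ
  numStates : ℕ → ℕ
  numActions : Fin n → ℕ
  allowed : ∀ h : ℕ, Fin (numStates h) → Finset (∀ i : Fin n, Fin (numActions i))
  transProb : ∀ h : ℕ, Fin (numStates h) → (∀ i : Fin n, Fin (numActions i)) →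
    Fin (numStates (h + 1)) → R
  /-- expected immediate reward of each player -/
  reward : ∀ h : ℕ, Fin (numStates h) → (∀ i : Fin n, Fin (numActions i)) → Fin n → R

/-- The two equilibrium concepts: correlated and coarse correlated equilibrium. -/
inductive EqConcept where
  | CE
  | CCE

namespace ACGame

section Types

variable {R : Type} (G : ACGame R)

abbrev State (h : ℕ) : Type := Fin (G.numStates h)

abbrev Act (i : Fin G.n) : Type := Fin (G.numActions i)

abbrev JointAct : Type := ∀ i : Fin G.n, Fin (G.numActions i)

/-- The number of joint actions. -/
def numJoint : ℕ := ∏ i, G.numActions i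

/-- An enumeration of the joint actions. -/
def enum : G.JointAct ≃ Fin G.numJoint := finPiFinEquiv

/-- Markovian joint policies: `π h s a` is the probability of the joint action `a`. -/
abbrev Policy : Type := ∀ h : ℕ, G.State h → G.JointAct → R

/-- The size of the description of the game, as a number of table entries. -/
def size : ℕ :=
  G.n + G.H + ∑ i, G.numActions i + ∑ h ∈ Finset.range (G.H + 1), G.numStates h
    + ∑ h ∈ Finset.range G.H,
        G.numStates h * G.numJoint * (1 + G.n + G.numStates (h + 1))

/-- Histories `(s₀, a₀, s₁, …, aₕ₋₁, sₕ)`. -/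
inductive History : ℕ → Type
  | start (s : Fin (G.numStates 0)) : History 0
  | snoc {h : ℕ} (τ : History h) (a : ∀ i : Fin G.n, Fin (G.numActions i))
      (s : Fin (G.numStates (h + 1))) : History (h + 1)

/-- The current state of a history. -/
def History.last {G : ACGame R} : {h : ℕ} → G.History h → G.State h
  | _, .start s => s
  | _, .snoc _ _ s => s

/-- Continuations `(aₕ, sₕ₊₁, aₕ₊₁, …, sₕ₊ₖ)` of length `k` from time `h`. -/
def Cont : (k h : ℕ) → Type
  | 0, _ => Unit
  | k + 1, h => G.JointAct × G.State (h + 1) × Cont k (h + 1)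

instance contFintype : (k h : ℕ) → Fintype (G.Cont k h)
  | 0, _ => inferInstanceAs (Fintype Unit)
  | k + 1, h =>
    letI := contFintype k (h + 1)
    inferInstanceAs (Fintype (G.JointAct × G.State (h + 1) × G.Cont k (h + 1)))

end Types

variable (G : ACGame ℝ)

/-- The transition weights are probability distributions for all allowed actions. -/
def IsMarkovGame : Prop :=
  ∀ h < G.H, ∀ s, ∀ a ∈ G.allowed h s,
    (∀ s', 0 ≤ G.transProb h s a s') ∧ ∑ s', G.transProb h s a s' = 1

/-- Every state of every decision time has an allowed joint action. -/
def IsFeasibleGame : Prop :=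
  ∀ h < G.H, ∀ s, (G.allowed h s).Nonempty

/-- `σ` is a probability distribution on joint actions with support in `X`. -/
def IsDistOn {G : ACGame ℝ} (X : Finset G.JointAct) (σ : G.JointAct → ℝ) : Prop :=
  (∀ a, 0 ≤ σ a) ∧ ∑ a, σ a = 1 ∧ ∀ a, a ∉ X → σ a = 0

/-- History-dependent joint policies. -/
abbrev HistPolicy : Type := ∀ h : ℕ, G.History h → G.JointAct → ℝ

/-! #### Laws of trajectories and values -/

/-- The probability of a continuation when a history-dependent policy is followed after `τ`. -/
noncomputable def histProb (π : G.HistPolicy) : (k h : ℕ) → G.History h → G.Cont k h → ℝ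
  | 0, _, _, _ => 1
  | k + 1, h, τ, (a, s', ω) =>
    π h τ a * G.transProb h τ.last a s' * histProb π k (h + 1) (.snoc τ a s') ω

/-- The probability of a continuation when a Markovian policy is followed from state `s`. -/
noncomputable def markovProb (π : G.Policy) : (k h : ℕ) → G.State h → G.Cont k h → ℝ
  | 0, _, _, _ => 1
  | k + 1, h, s, (a, s', ω) =>
    π h s a * G.transProb h s a s' * markovProb π k (h + 1) s' ω

/-- The sum of the (expected immediate) rewards of player `i` along a continuation. -/
noncomputable def totalReward (i : Fin G.n) : (k h : ℕ) → G.State h → G.Cont k h → ℝ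
  | 0, _, _, _ => 0
  | k + 1, h, s, (a, s', ω) => G.reward h s a i + totalReward i k (h + 1) s' ω

/-- Expected total reward of player `i` from time `h` to the end, given the history `τ`. -/
noncomputable def histValue (π : G.HistPolicy) (i : Fin G.n) (h : ℕ) (τ : G.History h) : ℝ :=
  ∑ ω : G.Cont (G.H - h) h,
    G.histProb π (G.H - h) h τ ω * G.totalReward i (G.H - h) h τ.last ω

/-- Expected total reward of player `i` from time `h` to the end, given the state `s`. -/
noncomputable def markovValue (π : G.Policy) (i : Fin G.n) (h : ℕ) (s : G.State h) : ℝ :=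
  ∑ ω : G.Cont (G.H - h) h,
    G.markovProb π (G.H - h) h s ω * G.totalReward i (G.H - h) h s ω

/-! #### Feasible policies, deviations, Markov-perfect equilibria -/

/-- Feasibility of a Markovian policy. -/
def IsFeasible (π : G.Policy) : Prop :=
  ∀ h < G.H, ∀ s, IsDistOn (G.allowed h s) (π h s)

/-- Feasibility of a history-dependent policy, at all histories. -/
def IsHistFeasible (π : G.HistPolicy) : Prop :=
  ∀ h < G.H, ∀ τ : G.History h, IsDistOn (G.allowed h τ.last) (π h τ)

/-- Feasibility of a history-dependent policy for `k` steps in the subgame that starts after `τ`: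
only the histories that the policy itself reaches with positive probability count. -/
def IsFeasibleAfter (π : G.HistPolicy) : (k h : ℕ) → G.History h → Prop
  | 0, _, _ => True
  | k + 1, h, τ =>
    IsDistOn (G.allowed h τ.last) (π h τ) ∧
      ∀ a s', 0 < π h τ a → 0 < G.transProb h τ.last a s' →
        IsFeasibleAfter π k (h + 1) (.snoc τ a s')

/-- A deviation of player `i`: `κ h τ b` is the distribution of the action that the player
plays after the history `τ` in place of the recommended action `b`. -/
abbrev Deviation (i : Fin G.n) : Type := ∀ h : ℕ, G.History h → G.Act i → G.Act i → ℝ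

/-- For CE every (randomized, history-dependent) strategy modification is a deviation. For CCE the
deviation is a history-dependent policy of the player, which does not see the recommendation. -/
def IsDeviation {G : ACGame ℝ} (c : EqConcept) {i : Fin G.n} (κ : G.Deviation i) : Prop :=
  (∀ h τ b, (∀ b', 0 ≤ κ h τ b b') ∧ ∑ b', κ h τ b b' = 1) ∧
    match c with
    | .CE => True
    | .CCE => ∀ h τ b₁ b₂, κ h τ b₁ = κ h τ b₂

/-- The joint policy in which the others follow `π` and player `i` deviates by `κ`. If `κ` ignores
the recommendation, this is the product of `κ` with the marginal of `π` on the other players. -/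
noncomputable def deviate (π : G.Policy) (i : Fin G.n) (κ : G.Deviation i) : G.HistPolicy :=
  fun h τ a => ∑ b : G.Act i, π h τ.last (Function.update a i b) * κ h τ b (a i)

/-- `π` is a (feasible) Markov-perfect equilibrium of the given kind. -/
def IsMPE (c : EqConcept) (π : G.Policy) : Prop :=
  G.IsFeasible π ∧
    ∀ (i : Fin G.n) (h : ℕ), h ≤ G.H → ∀ (τ : G.History h) (κ : G.Deviation i), IsDeviation c κ →
      ¬ G.IsHistFeasible (G.deviate π i κ) ∨
        G.markovValue π i h τ.last ≥ G.histValue (G.deviate π i κ) i h τ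

/-- The same with more deviations: a deviation only has to be feasible in the subgame at hand. -/
def IsSubgameMPE (c : EqConcept) (π : G.Policy) : Prop :=
  G.IsFeasible π ∧
    ∀ (i : Fin G.n) (h : ℕ), h ≤ G.H → ∀ (τ : G.History h) (κ : G.Deviation i), IsDeviation c κ →
      ¬ G.IsFeasibleAfter (G.deviate π i κ) (G.H - h) h τ ∨
        G.markovValue π i h τ.last ≥ G.histValue (G.deviate π i κ) i h τ

/-! #### Stage games and the constrained linear program -/

/-- The stage game at `(h, s)`: the utility of an action that is not allowed is `-∞`. -/
noncomputable def stageUtility (π : G.Policy) (h : ℕ) (s : G.State h) (i : Fin G.n)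
    (a : G.JointAct) : EReal :=
  if a ∈ G.allowed h s then
    ((G.reward h s a i + ∑ s', G.transProb h s a s' * G.markovValue π i (h + 1) s' : ℝ) : EReal)
  else ⊥

/-- `σ` (extended by zero outside `X`) solves the constrained CE/CCE program of the
action-constrained matrix game with allowed set `X` and utility `u`. The arithmetic is that of the
extended reals, where `x - (-∞) = ∞` for real `x`, and `0 * ∞ = 0`. -/
def IsCLPSolution {G : ACGame ℝ} (c : EqConcept) (X : Finset G.JointAct)
    (u : Fin G.n → G.JointAct → EReal) (σ : G.JointAct → ℝ) : Prop :=
  (match c with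
    | .CCE => ∀ (i : Fin G.n) (b : G.Act i),
        0 ≤ ∑ a ∈ X, (σ a : EReal) * (u i a - u i (Function.update a i b))
    | .CE => ∀ (i : Fin G.n) (b b' : G.Act i),
        0 ≤ ∑ a ∈ X with a i = b, (σ a : EReal) * (u i a - u i (Function.update a i b'))) ∧
  ∑ a ∈ X, σ a = 1 ∧ (∀ a ∈ X, 0 ≤ σ a) ∧ ∀ a, a ∉ X → σ a = 0

/-- `π` solves, at every stage, the constrained program of the stage game that `π` induces. -/
def SolvesAllStages (c : EqConcept) (π : G.Policy) : Prop :=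
  ∀ h < G.H, ∀ s, IsCLPSolution c (G.allowed h s) (G.stageUtility π h s) (π h s)

end ACGame

/-! ### Programs over the reals with unit cost, calling a linear-program solver -/

/-- A system of linear inequalities `∑ j, c j * x j ≥ d` in `N` variables, one for each `(c, d)`. -/
structure LinSys (R : Type) (N : ℕ) where
  rows : List ((Fin N → R) × R)

/-- The number of variables plus the number of entries of the system. -/
def LinSys.size {R : Type} {N : ℕ} (L : LinSys R N) : ℕ := N + L.rows.length * (N + 1)

def LinSys.Sat {N : ℕ} (L : LinSys ℝ N) (x : Fin N → ℝ) : Prop :=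
  ∀ r ∈ L.rows, ∑ j, r.1 j * x j ≥ r.2

/-- A linear-program feasibility solver, with its running time on each input. -/
structure LPSolver where
  solve : ∀ {N : ℕ}, LinSys ℝ N → Option (Fin N → ℝ)
  time : ∀ {N : ℕ}, LinSys ℝ N → ℕ

/-- The solver finds a solution whenever there is one, and answers `none` otherwise. -/
def LPSolver.IsCorrect (lp : LPSolver) : Prop :=
  ∀ {N : ℕ} (L : LinSys ℝ N),
    (∀ x, lp.solve L = some x → L.Sat x) ∧ (lp.solve L = none → ¬ ∃ x, L.Sat x)

/-- The running time is at most the polynomial `q` of the size of the system. -/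
def LPSolver.RunsIn (lp : LPSolver) (q : Polynomial ℕ) : Prop :=
  ∀ {N : ℕ} (L : LinSys ℝ N), lp.time L ≤ q.eval L.size

inductive ArithOp where
  | add
  | sub
  | mul

/-- Programs that compute with numbers of an abstract type `R`: besides returning a result they can
perform a bookkeeping step (a memory access, an index operation, a loop iteration), load an integer
constant, do an arithmetic operation, compare two numbers, or call the LP solver. Each of these
instructions counts as one step. -/
inductive Prog (R : Type) (α : Type) : Type where
  | ret (x : α)
  | tick (p : Prog R α)
  | const (z : ℤ) (k : R → Prog R α)
  | arith (o : ArithOp) (x y : R) (k : R → Prog R α)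
  | lt (x y : R) (k : Bool → Prog R α)
  | call {N : ℕ} (L : LinSys R N) (k : Option (Fin N → R) → Prog R α)

namespace Prog

variable {R : Type}

def bind {α β : Type} : Prog R α → (α → Prog R β) → Prog R β
  | ret x, f => f x
  | tick p, f => tick (bind p f)
  | const z k, f => const z (fun x => bind (k x) f)
  | arith o x y k, f => arith o x y (fun z => bind (k z) f)
  | lt x y k, f => lt x y (fun b => bind (k b) f)
  | call L k, f => call L (fun x => bind (k x) f)

instance : Monad (Prog R) where
  pure := ret
  bind := bind

/-- The result of running a program over the reals: the value, the number of steps of the program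
itself, and the systems on which the solver was called. -/
structure Outcome (α : Type) where
  value : α
  steps : ℕ
  calls : List (Σ N : ℕ, LinSys ℝ N)

def ArithOp.eval : ArithOp → ℝ → ℝ → ℝ
  | .add, x, y => x + y
  | .sub, x, y => x - y
  | .mul, x, y => x * y

noncomputable def run (lp : LPSolver) {α : Type} : Prog ℝ α → Outcome α
  | ret x => ⟨x, 0, []⟩
  | tick p => let o := run lp p; ⟨o.value, o.steps + 1, o.calls⟩
  | const z k => let o := run lp (k (z : ℝ)); ⟨o.value, o.steps + 1, o.calls⟩
  | arith op x y k =>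
    let o := run lp (k (ArithOp.eval op x y)); ⟨o.value, o.steps + 1, o.calls⟩
  | lt x y k =>
    let o := run lp (k (@decide (x < y) (Classical.propDecidable _)))
    ⟨o.value, o.steps + 1, o.calls⟩
  | call L k =>
    let o := run lp (k (lp.solve L)); ⟨o.value, o.steps + 1, ⟨_, L⟩ :: o.calls⟩

/-- The total running time: the program's own steps and the time spent by the solver. -/
def Outcome.time {α : Type} (o : Outcome α) (lp : LPSolver) : ℕ :=
  o.steps + (o.calls.map (fun L => lp.time L.2)).sum

def ticks : ℕ → Prog R Unit
  | 0 => ret ()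
  | k + 1 => tick (ticks k)

/-- Get a stored datum with an address that takes `k` index operations to compute. -/
def access {α : Type} (k : ℕ) (x : α) : Prog R α := do
  ticks (k + 1)
  ret x

def num (z : ℤ) : Prog R R := const z ret

def add (x y : R) : Prog R R := arith .add x y ret

def sub (x y : R) : Prog R R := arith .sub x y ret

def mul (x y : R) : Prog R R := arith .mul x y ret

def less (x y : R) : Prog R Bool := lt x y ret

/-- Loop: fill a table with `N` entries. -/
def tabulate {β : Type} : (N : ℕ) → (Fin N → Prog R β) → Prog R (Fin N → β)
  | 0, _ => ret Fin.elim0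
  | N + 1, f => tick do
    let x ← f 0
    let g ← tabulate N (fun j => f j.succ)
    ret (Fin.cons x g)

/-- Loop with an accumulator. -/
def fold {β : Type} : (N : ℕ) → β → (Fin N → β → Prog R β) → Prog R β
  | 0, x, _ => ret x
  | N + 1, x, f => tick do
    let y ← f 0 x
    fold N y (fun j => f j.succ)

/-- Loop that emits a list. -/
def collect {β : Type} : (N : ℕ) → (Fin N → Prog R (List β)) → Prog R (List β)
  | 0, _ => ret []
  | N + 1, f => tick do
    let l ← f 0
    let l' ← collect N (fun j => f j.succ)
    ret (l ++ l')

end Prog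

/-! ### The constrained solver -/

namespace ACGame

open Prog

variable {R : Type} (G : ACGame R)

/-- Fill a table indexed by joint actions. -/
def tabulateJoint {β : Type} (f : G.JointAct → Prog R β) : Prog R (G.JointAct → β) := do
  let g ← tabulate G.numJoint (fun j => f (G.enum.symm j))
  ret (fun a => g (G.enum a))

/-- Membership of a joint action in the allowed set. -/
def test (h : ℕ) (s : G.State h) (a : G.JointAct) : Prog R Bool :=
  access G.n (decide (a ∈ G.allowed h s))

/-- The utilities of the stage game, where `none` stands for `-∞`. -/
def stageProg (h : ℕ) (V : G.State (h + 1) → Fin G.n → R) (s : G.State h) :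
    Prog R (Fin G.n → G.JointAct → Option R) :=
  tabulate G.n fun i => G.tabulateJoint fun a => do
    if ← G.test h s a then
      let z ← num 0
      let e ← fold (G.numStates (h + 1)) z fun s' acc => do
        let p ← access G.n (G.transProb h s a s')
        let v ← access 0 (V s' i)
        add acc (← mul p v)
      let r ← access G.n (G.reward h s a i)
      ret (some (← add r e))
    else ret none

/-- A number that is smaller by at least one than all finite utilities. -/
def penaltyProg (Q : Fin G.n → G.JointAct → Option R) : Prog R R := do
  let z ← num 0
  let m ← fold G.n z fun i acc =>
    fold G.numJoint acc fun j acc => do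
      match ← access G.n (Q i (G.enum.symm j)) with
      | none => ret acc
      | some q => if ← less q acc then ret q else ret acc
  sub m (← num 1)

/-- The coefficients of the inequality against deviations of player `i` to the action `b'`. Only
the allowed joint actions that satisfy `cond` enter. -/
def devRow (h : ℕ) (s : G.State h) (u : Fin G.n → G.JointAct → R) (i : Fin G.n) (b' : G.Act i)
    (cond : G.JointAct → Bool) : Prog R (List ((Fin G.numJoint → R) × R)) := do
  let z ← num 0
  let c ← tabulate G.numJoint fun j => do
    let a := G.enum.symm j
    let ok ← access 0 (cond a)
    if (← G.test h s a) && ok then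
      let x ← access G.n (u i a)
      let y ← access G.n (u i (Function.update a i b'))
      sub x y
    else ret z
  ret [(c, z)]

/-- The inequalities of the constrained program, in the variables `σ a`. -/
def clpProg (c : EqConcept) (h : ℕ) (s : G.State h) (u : Fin G.n → G.JointAct → R) :
    Prog R (LinSys R G.numJoint) := do
  let z ← num 0
  let one ← num 1
  let neg ← num (-1)
  let dev ← match c with
    | .CCE => collect G.n fun i => collect (G.numActions i) fun b' =>
        G.devRow h s u i b' (fun _ => true)
    | .CE => collect G.n fun i => collect (G.numActions i) fun b =>
        collect (G.numActions i) fun b' => G.devRow h s u i b' (fun a => decide (a i = b))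
  let mass ← tabulate G.numJoint fun j => do
    if ← G.test h s (G.enum.symm j) then ret one else ret z
  let negMass ← tabulate G.numJoint fun j => do
    if ← G.test h s (G.enum.symm j) then ret neg else ret z
  let pos ← collect G.numJoint fun j => do
    if ← G.test h s (G.enum.symm j) then
      let e ← tabulate G.numJoint fun j' => if j' = j then ret one else ret z
      ret [(e, z)]
    else ret []
  ret ⟨dev ++ [(mass, one), (negMass, neg)] ++ pos⟩

/-- One stage: solve the constrained program of the stage game at `(h, s)` and compute the values.
As the entries of a linear program are real numbers, `-∞` is replaced by a real number that is
smaller than all utilities. -/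
def solveStage (c : EqConcept) (h : ℕ) (V : G.State (h + 1) → Fin G.n → R) (s : G.State h) :
    Prog R ((G.JointAct → R) × (Fin G.n → R)) := do
  let z ← num 0
  let Q ← G.stageProg h V s
  let M ← G.penaltyProg Q
  let u ← tabulate G.n fun i => G.tabulateJoint fun a => do
    match ← access G.n (Q i a) with
    | some q => ret q
    | none => ret M
  let L ← G.clpProg c h s u
  let answer ← call L ret
  let σ ← G.tabulateJoint fun a => do
    if ← G.test h s a then
      match answer with
      | some x => access G.n (x (G.enum a))
      | none => ret z
    else ret z
  let v ← tabulate G.n fun i => fold G.numJoint z fun j acc => do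
    let a := G.enum.symm j
    if ← G.test h s a then
      let p ← access G.n (σ a)
      let q ← access G.n (u i a)
      add acc (← mul p q)
    else ret acc
  ret (σ, v)

/-- Backward induction over the last `k` decision times, the first of which is `h`. -/
def backward (c : EqConcept) : (k h : ℕ) → Prog R (G.Policy × (G.State h → Fin G.n → R))
  | 0, h => do
    let z ← num 0
    let V ← tabulate (G.numStates h) fun _ => tabulate G.n fun _ => ret z
    ret (fun _ _ _ => z, V)
  | k + 1, h => tick do
    let (π, V) ← backward c k (h + 1)
    let stage ← tabulate (G.numStates h) (G.solveStage c h V)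
    ret (Function.update π h (fun s => (stage s).1), fun s => (stage s).2)

/-- The constrained solver. -/
def constrainedSolver (c : EqConcept) : Prog R G.Policy := do
  let (π, _) ← G.backward c G.H 0
  ret π

end ACGame

/-! ### Correlated equilibria of action-constrained matrix games -/

section MatrixGames

open Function

/-! Solvability of a stage rests on a linear duality argument in the style of Hart and Schmeidler.
Replace `-∞` by a real number not exceeding any utility, so that joint actions outside `X` are worst
for everyone. If no distribution on `X` satisfies the CE inequalities, separation
(`exists_mixture_or_weights`) gives nonnegative weights on the deviations `(i, b, b')` whose
weighted sum of losses is negative at every point of `X`. After a small positive perturbation, each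
player's weights form a positive matrix with a balanced vector (`exists_pos_stationary`). Under the
product of these vectors each player's weighted loss sums to zero. Yet it is negative on `X` and
nonpositive off `X`, a contradiction. Hence `exists_correlatedEquilibrium_supported`; CCE follows by
summing over recommendations.

A solution with the real penalty also solves the extended-real program, because a forbidden target
there only contributes `0` or `+∞`. Conversely, a feasible deviation never moves positive mass out
of `X`, so the infinite terms are absent from the inequalities it uses, and averaging these gives
`IsCLPSolution.deviation_le`. Backward induction turns this one-step optimality into optimality
against history-dependent deviations (`histValue_deviate_le`). Only branches of positive probability
matter, which yields the strong form of equilibrium.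

For the algorithm, `Runs` tracks the result, the steps and the solver calls at once. Its rules are
applied along the program, with polynomials chosen before the game and the solver. Since the linear
system of each stage is solvable, a correct solver must return a solution, and `IsPartialSolution`
is the invariant of the backward induction. -/

lemma sum_sum_update_swap {ι M : Type*} [DecidableEq ι] [Fintype ι] {A : ι → Type*}
    [∀ i, Fintype (A i)] [AddCommMonoid M] (i : ι) (F : (∀ j, A j) → A i → M) :
    ∑ a, ∑ b, F a b = ∑ a, ∑ b, F (update a i b) (a i) := by
  rw [← Fintype.sum_prod_type', ← Fintype.sum_prod_type']
  -- Exchanging `a i` with `b` is an involution on the pairs `(a, b)`.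
  refine Finset.sum_bij' (fun p _ => (update p.1 i p.2, p.1 i))
    (fun p _ => (update p.1 i p.2, p.1 i)) ?_ ?_ ?_ ?_ ?_ <;> simp

/-- A matrix with positive entries has a positive vector of balanced weights. -/
lemma exists_pos_stationary {B : Type*} [Fintype B] [Nonempty B] (w : B → B → ℝ)
    (hw : ∀ b b', 0 < w b b') :
    ∃ x : B → ℝ, (∀ b, 0 < x b) ∧ ∀ b, ∑ b', x b' * w b' b = x b * ∑ b', w b b' := by
  classical
  -- All row sums vanish, so the constant vector is in the kernel and a left null vector exists as
  -- well.
  let L : Matrix B B ℝ := fun b b' => w b b' - if b = b' then ∑ c, w b c else 0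
  have hdet : L.det = 0 := by
    rw [← Matrix.exists_mulVec_eq_zero_iff]
    refine ⟨fun _ => 1, fun h => ?_, ?_⟩
    · exact one_ne_zero (congrFun h (Classical.arbitrary B))
    · ext b
      simp [Matrix.mulVec, dotProduct, L, Finset.sum_sub_distrib]
  obtain ⟨z, hz, hzL⟩ := Matrix.exists_vecMul_eq_zero_iff.2 hdet
  have hbal : ∀ b, ∑ b', z b' * w b' b = z b * ∑ b', w b b' := by
    intro b
    have := congrFun hzL b
    simp only [Matrix.vecMul, dotProduct, L, mul_sub, Finset.sum_sub_distrib, mul_ite, mul_zero,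
      Finset.sum_ite_eq', Finset.mem_univ, if_true, Pi.zero_apply] at this
    linarith
  have hW : ∀ b, 0 < ∑ b', w b b' := fun b =>
    Finset.sum_pos (fun b' _ => hw b b') Finset.univ_nonempty
  -- The null vector may change sign. The triangle inequality gives one half of the balance for its
  -- absolute value, and equality of the totals forces equality for each `b`.
  have hle : ∀ b ∈ Finset.univ, |z b| * ∑ b', w b b' ≤ ∑ b', |z b'| * w b' b := by
    intro b _
    rw [← abs_of_pos (hW b), ← abs_mul, ← hbal]
    refine (Finset.abs_sum_le_sum_abs _ _).trans (le_of_eq ?_)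
    exact Finset.sum_congr rfl fun b' _ => by rw [abs_mul, abs_of_pos (hw b' b)]
  have hsum : ∑ b, |z b| * ∑ b', w b b' = ∑ b, ∑ b', |z b'| * w b' b := by
    rw [Finset.sum_comm]
    simp only [Finset.mul_sum]
  have heq := (Finset.sum_eq_sum_iff_of_le hle).1 hsum
  refine ⟨fun b => |z b|, fun b => ?_, fun b => (heq b (Finset.mem_univ _)).symm⟩
  obtain ⟨b₀, hb₀⟩ := Function.ne_iff.1 hz
  have hpos : 0 < ∑ b', |z b'| * w b' b :=
    Finset.sum_pos' (fun b' _ => mul_nonneg (abs_nonneg _) (hw _ _).le)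
      ⟨b₀, Finset.mem_univ _, mul_pos (abs_pos.2 hb₀) (hw _ _)⟩
  rw [← heq b (Finset.mem_univ _)] at hpos
  exact pos_of_mul_pos_left hpos (hW b).le

/-- A theorem of the alternative for mixtures of points of a finite set. -/
lemma exists_mixture_or_weights {A K : Type*} [Fintype A] [Fintype K] (X : Finset A)
    (D : K → A → ℝ) :
    (∃ σ : A → ℝ, (∀ a, 0 ≤ σ a) ∧ ∑ a, σ a = 1 ∧ (∀ a, a ∉ X → σ a = 0) ∧
      ∀ k, 0 ≤ ∑ a, σ a * D k a) ∨
    ∃ w : K → ℝ, (∀ k, 0 ≤ w k) ∧ ∀ a ∈ X, ∑ k, w k * D k a < 0 := by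
  classical
  refine or_iff_not_imp_left.2 fun hno => ?_
  let S : Set (A → ℝ) := stdSimplex ℝ A ∩ {σ | ∀ a, a ∉ X → σ a = 0}
  have hSc : IsCompact S := by
    refine (isCompact_stdSimplex ℝ A).inter_right ?_
    simp only [Set.ofPred_forall]
    exact isClosed_iInter fun a => isClosed_iInter fun _ =>
      isClosed_eq (continuous_apply a) continuous_const
  have hSv : Convex ℝ S := by
    refine (convex_stdSimplex ℝ A).inter ?_
    intro x hx y hy s t _ _ _ a ha
    simp [hx a ha, hy a ha]
  let T : (A → ℝ) →ₗ[ℝ] (K → ℝ) :=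
    { toFun := fun σ k => ∑ a, σ a * D k a
      map_add' := fun x y => by ext k; simp [add_mul, Finset.sum_add_distrib]
      map_smul' := fun c x => by ext k; simp [Finset.mul_sum, mul_assoc] }
  have hTc : Continuous T := T.continuous_of_finiteDimensional
  have horth : IsClosed (Set.Ici (0 : K → ℝ)) := isClosed_Ici
  have hdisj : Disjoint (T '' S) (Set.Ici (0 : K → ℝ)) := by
    rw [Set.disjoint_left]
    rintro _ ⟨σ, ⟨⟨h0, h1⟩, h2⟩, rfl⟩ h
    exact hno ⟨σ, h0, h1, h2, fun k => h k⟩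
  -- Separate the compact convex set of attainable vectors from the nonnegative orthant; the weights
  -- are the coordinates of the separating functional.
  obtain ⟨f, u, v, hu, huv, hv⟩ := geometric_hahn_banach_compact_closed
    (hSv.linear_image T) (hSc.image hTc) (convex_Ici 0) horth hdisj
  have hv0 : v < 0 := by simpa using hv 0 (Set.mem_Ici.2 le_rfl)
  refine ⟨fun k => f (Pi.single k 1), fun k => ?_, fun a ha => ?_⟩
  -- If a coordinate of `f` were negative, a nonnegative multiple of that basis vector would have
  -- `f`-value exactly `v`.
  · by_contra! hneg
    have := hv ((v / f (Pi.single k 1)) • Pi.single k 1) (by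
      rw [Set.mem_Ici]
      exact smul_nonneg (div_nonneg_of_nonpos hv0.le hneg.le)
        (Pi.single_nonneg.2 zero_le_one))
    rw [map_smul, smul_eq_mul, div_mul_cancel₀ _ hneg.ne] at this
    exact lt_irrefl _ this
  · have h1 := hu _ ⟨Pi.single a 1, ⟨single_mem_stdSimplex ℝ a, fun b hb => by
      rw [Pi.single_eq_of_ne]; rintro rfl; exact hb ha⟩, rfl⟩
    have h2 : T (Pi.single a 1) = ∑ k, D k a • (Pi.single k 1 : K → ℝ) := by
      ext k
      simp [T, Pi.single_apply]
    rw [h2, map_sum] at h1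
    simp only [map_smul, smul_eq_mul] at h1
    have h3 : ∑ k, f (Pi.single k 1) * D k a = ∑ k, D k a * f (Pi.single k 1) :=
      Finset.sum_congr rfl fun k _ => mul_comm _ _
    rw [h3]
    linarith

/-- If every player likes the joint actions outside of `X` least, then the matrix game has a
correlated equilibrium with support in `X`. -/
theorem exists_correlatedEquilibrium_supported {ι : Type*} [Fintype ι] [DecidableEq ι]
    {A : ι → Type*} [∀ i, Fintype (A i)] [∀ i, DecidableEq (A i)]
    (X : Finset (∀ i, A i)) (hX : X.Nonempty) (w : ι → (∀ i, A i) → ℝ)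
    (hw : ∀ i a a', a ∉ X → w i a ≤ w i a') :
    ∃ σ : (∀ i, A i) → ℝ, (∀ a, 0 ≤ σ a) ∧ ∑ a, σ a = 1 ∧ (∀ a, a ∉ X → σ a = 0) ∧
      ∀ (i : ι) (b b' : A i),
        0 ≤ ∑ a, σ a * if a i = b then w i a - w i (update a i b') else 0 := by
  rcases exists_mixture_or_weights X
    (fun (k : Σ i, A i × A i) a =>
      if a k.1 = k.2.1 then w k.1 a - w k.1 (update a k.1 k.2.2) else 0) with
    ⟨σ, h0, h1, h2, h3⟩ | ⟨l, hl0, hl⟩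
  · exact ⟨σ, h0, h1, h2, fun i b b' => h3 ⟨i, b, b'⟩⟩
  exfalso
  -- Balanced vectors need strictly positive weights; finitely many strict inequalities survive a
  -- small shift.
  obtain ⟨ε, hε, hlε⟩ : ∃ ε : ℝ, 0 < ε ∧ ∀ a ∈ X, ∑ k : Σ i, A i × A i, (l k + ε) *
      (if a k.1 = k.2.1 then w k.1 a - w k.1 (update a k.1 k.2.2) else 0) < 0 := by
    have : ∀ᶠ ε : ℝ in nhds 0, ∀ a ∈ X, ∑ k : Σ i, A i × A i, (l k + ε) *
      (if a k.1 = k.2.1 then w k.1 a - w k.1 (update a k.1 k.2.2) else 0) < 0 := by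
      rw [Filter.eventually_all_finset]
      intro a ha
      refine ContinuousAt.eventually_lt (by fun_prop) continuousAt_const ?_
      simpa using hl a ha
    obtain ⟨ε, h1, h2⟩ := ((this.filter_mono nhdsWithin_le_nhds).and
      (self_mem_nhdsWithin (s := Set.Ioi (0 : ℝ)))).exists
    exact ⟨ε, h2, h1⟩
  obtain ⟨a₀, ha₀⟩ := hX
  have hst : ∀ i, ∃ x : A i → ℝ, (∀ b, 0 < x b) ∧
      ∀ b, ∑ b', x b' * (l ⟨i, b', b⟩ + ε) = x b * ∑ b', (l ⟨i, b, b'⟩ + ε) := by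
    intro i
    have : Nonempty (A i) := ⟨a₀ i⟩
    exact exists_pos_stationary _ fun b b' => by
      have := hl0 ⟨i, b, b'⟩
      linarith
  choose x hx0 hx using hst
  let y : (∀ i, A i) → ℝ := fun a => ∏ i, x i (a i)
  have hy : ∀ a, 0 < y a := fun a => Finset.prod_pos fun i _ => hx0 i _
  let g : ι → (∀ i, A i) → ℝ := fun i a =>
    ∑ b', (l ⟨i, a i, b'⟩ + ε) * (w i a - w i (update a i b'))
  have hg : ∀ a, ∑ k : Σ i, A i × A i, (l k + ε) *
      (if a k.1 = k.2.1 then w k.1 a - w k.1 (update a k.1 k.2.2) else 0) = ∑ i, g i a := by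
    intro a
    rw [Fintype.sum_sigma]
    refine Finset.sum_congr rfl fun i _ => ?_
    rw [Fintype.sum_prod_type, Finset.sum_eq_single (a i)]
    · simp [g]
    · intro b _ hb
      simp [hb.symm]
    · simp
  -- Exchanging `a i` and `b'` in the subtracted sum reduces the claim to the balance equation of `x
  -- i`, times the common product over the other players.
  have hzero : ∀ i, ∑ a, y a * g i a = 0 := by
    intro i
    have e1 : ∑ a, y a * g i a = ∑ a, ∑ b', y a * (l ⟨i, a i, b'⟩ + ε) * w i a
        - ∑ a, ∑ b', y a * (l ⟨i, a i, b'⟩ + ε) * w i (update a i b') := by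
      rw [← Finset.sum_sub_distrib]
      refine Finset.sum_congr rfl fun a _ => ?_
      rw [← Finset.sum_sub_distrib, Finset.mul_sum]
      exact Finset.sum_congr rfl fun b _ => by ring
    rw [e1, sub_eq_zero, sum_sum_update_swap i
      (fun a b' => y a * (l ⟨i, a i, b'⟩ + ε) * w i (update a i b'))]
    refine Finset.sum_congr rfl fun a _ => ?_
    simp only [update_self, update_idem, update_eq_self]
    rw [← Finset.sum_mul, ← Finset.sum_mul]
    congr 1
    have hy' : ∀ b, y (update a i b) = x i b * ∏ j ∈ Finset.univ.erase i, x j (a j) := by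
      intro b
      simp only [y]
      rw [← Finset.mul_prod_erase _ _ (Finset.mem_univ i), update_self]
      congr 1
      refine Finset.prod_congr rfl fun j hj => ?_
      rw [update_of_ne (Finset.ne_of_mem_erase hj)]
    have hya := hy' (a i)
    rw [update_eq_self] at hya
    rw [← Finset.mul_sum, hya, mul_right_comm, ← hx, Finset.sum_mul]
    exact Finset.sum_congr rfl fun b _ => by rw [hy']; ring
  have htot : ∑ a, y a * ∑ i, g i a = 0 := by
    simp only [Finset.mul_sum]
    rw [Finset.sum_comm]
    exact Finset.sum_eq_zero fun i _ => hzero i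
  -- Outside `X` no deviation can hurt, so every term is nonpositive there; `a₀` makes the total
  -- strictly negative.
  have hneg : ∑ a, y a * ∑ i, g i a < 0 := by
    have hle : ∀ a, y a * ∑ i, g i a ≤ 0 := by
      intro a
      refine mul_nonpos_of_nonneg_of_nonpos (hy a).le ?_
      by_cases ha : a ∈ X
      · rw [← hg]; exact (hlε a ha).le
      · refine Finset.sum_nonpos fun i _ => Finset.sum_nonpos fun b _ => ?_
        refine mul_nonpos_of_nonneg_of_nonpos (add_nonneg (hl0 _) hε.le) ?_
        exact sub_nonpos.2 (hw i a _ ha)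
    refine Finset.sum_neg' (fun a _ => hle a) ⟨a₀, Finset.mem_univ _, ?_⟩
    rw [← hg]
    exact mul_neg_of_pos_of_neg (hy _) (hlε a₀ ha₀)
  exact hneg.ne htot

end MatrixGames

/-! ### Solutions of the constrained program and Markov-perfect equilibria -/

namespace ACGame

open Function

lemma coe_sum_ereal {α : Type*} (s : Finset α) (f : α → ℝ) :
    ((∑ a ∈ s, f a : ℝ) : EReal) = ∑ a ∈ s, (f a : EReal) :=
  map_sum (⟨⟨Real.toEReal, EReal.coe_zero⟩, EReal.coe_add⟩ : ℝ →+ EReal) f s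

section Stage

variable {G : ACGame ℝ}

/-- Utilities whose value outside of the allowed set is `-∞`. -/
noncomputable def restrictUtility (X : Finset G.JointAct) (q : Fin G.n → G.JointAct → ℝ) :
    Fin G.n → G.JointAct → EReal :=
  fun i a => if a ∈ X then (q i a : EReal) else ⊥

/-- The constraints against deviations, for real utilities. -/
def IsRealEq (c : EqConcept) (X : Finset G.JointAct) (w : Fin G.n → G.JointAct → ℝ)
    (σ : G.JointAct → ℝ) : Prop :=
  match c with
  | .CCE => ∀ (i : Fin G.n) (b : G.Act i), 0 ≤ ∑ a ∈ X, σ a * (w i a - w i (update a i b))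
  | .CE => ∀ (i : Fin G.n) (b b' : G.Act i),
      0 ≤ ∑ a ∈ X with a i = b, σ a * (w i a - w i (update a i b'))

/-- The comparison is termwise. Terms agree when `f a` is allowed; otherwise the extended term is
`+∞` or, at weight zero, `0` like the real one. The values of `w` off `X` are therefore irrelevant.
-/
lemma sum_ereal_gain_nonneg {X s : Finset G.JointAct} (hs : s ⊆ X)
    {w q : Fin G.n → G.JointAct → ℝ} (hwq : ∀ i, ∀ a ∈ X, w i a = q i a) {σ : G.JointAct → ℝ}
    (hσ : ∀ a ∈ X, 0 ≤ σ a) (i : Fin G.n) (f : G.JointAct → G.JointAct)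
    (h : 0 ≤ ∑ a ∈ s, σ a * (w i a - w i (f a))) :
    0 ≤ ∑ a ∈ s, (σ a : EReal) * (restrictUtility X q i a - restrictUtility X q i (f a)) := by
  have h' : (0 : EReal) ≤ ((∑ a ∈ s, σ a * (w i a - w i (f a)) : ℝ) : EReal) := by
    exact_mod_cast h
  rw [coe_sum_ereal] at h'
  refine h'.trans (Finset.sum_le_sum fun a ha => ?_)
  have haX := hs ha
  rw [restrictUtility, if_pos haX]
  by_cases hf : f a ∈ X
  · rw [restrictUtility, if_pos hf, hwq i a haX, hwq i _ hf]
    norm_cast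
  · rw [restrictUtility, if_neg hf, EReal.coe_sub_bot]
    rcases (hσ a haX).eq_or_lt with h0 | h0
    · simp [← h0]
    · rw [EReal.coe_mul_top_of_pos h0]
      exact le_top

/-- Infinite differences can occur only at weight zero, where `0 * ∞ = 0` removes them. -/
lemma sum_gain_nonneg {X s : Finset G.JointAct} (hs : s ⊆ X)
    {q : Fin G.n → G.JointAct → ℝ} {σ : G.JointAct → ℝ} (i : Fin G.n)
    (f : G.JointAct → G.JointAct) (hf : ∀ a ∈ s, σ a ≠ 0 → f a ∈ X)
    (h : 0 ≤ ∑ a ∈ s,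
      (σ a : EReal) * (restrictUtility X q i a - restrictUtility X q i (f a))) :
    0 ≤ ∑ a ∈ s, σ a * (q i a - q i (f a)) := by
  have h' : (0 : EReal) ≤ ((∑ a ∈ s, σ a * (q i a - q i (f a)) : ℝ) : EReal) := by
    rw [coe_sum_ereal]
    refine h.trans (le_of_eq (Finset.sum_congr rfl fun a ha => ?_))
    by_cases h0 : σ a = 0
    · simp [h0]
    · rw [restrictUtility, if_pos (hs ha), restrictUtility, if_pos (hf a ha h0)]
      norm_cast
  exact_mod_cast h'

/-- It suffices to solve the program in which `-∞` is replaced by arbitrary real numbers. -/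
lemma isCLPSolution_of_isRealEq {c : EqConcept} {X : Finset G.JointAct}
    {w q : Fin G.n → G.JointAct → ℝ} (hwq : ∀ i, ∀ a ∈ X, w i a = q i a) {σ : G.JointAct → ℝ}
    (hσ : IsDistOn X σ) (h : IsRealEq c X w σ) :
    IsCLPSolution c X (restrictUtility X q) σ := by
  obtain ⟨h0, h1, h2⟩ := hσ
  refine ⟨?_, ?_, fun a _ => h0 a, h2⟩
  · cases c with
    | CE =>
      intro i b b'
      exact sum_ereal_gain_nonneg (Finset.filter_subset _ _) hwq (fun a _ => h0 a) i
        (fun a => update a i b') (h i b b')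
    | CCE =>
      intro i b
      exact sum_ereal_gain_nonneg subset_rfl hwq (fun a _ => h0 a) i
        (fun a => update a i b) (h i b)
  · rw [← h1]
    exact Finset.sum_subset (Finset.subset_univ X) fun a _ ha => h2 a ha

lemma IsCLPSolution.isDistOn {c : EqConcept} {X : Finset G.JointAct}
    {u : Fin G.n → G.JointAct → EReal} {σ : G.JointAct → ℝ} (h : IsCLPSolution c X u σ) :
    IsDistOn X σ := by
  obtain ⟨-, h1, h0, h2⟩ := h
  refine ⟨fun a => ?_, ?_, h2⟩
  · by_cases ha : a ∈ X
    · exact h0 a ha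
    · exact (h2 a ha).ge
  · rw [← h1]
    exact (Finset.sum_subset (Finset.subset_univ X) fun a _ ha => h2 a ha).symm

/-- The program in which `-∞` is replaced by a sufficiently small real number is solvable. -/
lemma exists_isRealEq (c : EqConcept) {X : Finset G.JointAct} (hX : X.Nonempty)
    (w : Fin G.n → G.JointAct → ℝ) (hw : ∀ i a a', a ∉ X → w i a ≤ w i a') :
    ∃ σ, IsDistOn X σ ∧ IsRealEq c X w σ := by
  obtain ⟨σ, h0, h1, h2, h3⟩ := exists_correlatedEquilibrium_supported X hX w hw
  refine ⟨σ, ⟨h0, h1, h2⟩, ?_⟩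
  have hCE : IsRealEq .CE X w σ := by
    intro i b b'
    refine (h3 i b b').trans (le_of_eq ?_)
    rw [Finset.sum_filter, ← Finset.sum_subset (Finset.subset_univ X)]
    · exact Finset.sum_congr rfl fun a _ => by rw [mul_ite, mul_zero]
    · intro a _ ha
      rw [h2 a ha, zero_mul]
  cases c with
  | CE => exact hCE
  | CCE =>
    intro i b'
    -- The CCE inequality is the sum of the CE inequalities over the recommended action.
    rw [← Finset.sum_fiberwise X (fun a => a i)]
    exact Finset.sum_nonneg fun b _ => hCE i b b'

/-- A solution of the constrained program is not improved upon by an allowed deviation. -/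
lemma IsCLPSolution.deviation_le {c : EqConcept} {X : Finset G.JointAct}
    {q : Fin G.n → G.JointAct → ℝ} {σ : G.JointAct → ℝ}
    (h : IsCLPSolution c X (restrictUtility X q) σ) (i : Fin G.n) (k : G.Act i → G.Act i → ℝ)
    (hk0 : ∀ b b', 0 ≤ k b b') (hk1 : ∀ b, ∑ b', k b b' = 1)
    (hc : c = .CCE → ∀ b₁ b₂, k b₁ = k b₂)
    (hX : ∀ a, a ∉ X → ∑ b, σ (update a i b) * k b (a i) = 0) :
    ∑ a, (∑ b, σ (update a i b) * k b (a i)) * q i a ≤ ∑ a, σ a * q i a := by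
  have hd := h.isDistOn
  -- The deviating law at `update a i b'` is a sum of nonnegative terms, one of which is `σ a * k (a
  -- i) b'`. It vanishes off `X`, hence so does that term.
  have hmem : ∀ a b', σ a ≠ 0 → k (a i) b' ≠ 0 → update a i b' ∈ X := by
    intro a b' ha hb
    by_contra hnot
    have h1 := hX _ hnot
    rw [Finset.sum_eq_zero_iff_of_nonneg fun b _ => mul_nonneg (hd.1 _) (hk0 _ _)] at h1
    have h2 := h1 (a i) (Finset.mem_univ _)
    simp only [update_idem, update_eq_self, update_self, mul_eq_zero] at h2
    tauto
  -- The loss from deviating is an average, over the replacement action `b'`, of the left-hand sides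
  -- of the program.
  have key : ∑ a, σ a * q i a - ∑ a, (∑ b, σ (update a i b) * k b (a i)) * q i a =
      ∑ b', ∑ a ∈ X, k (a i) b' * (σ a * (q i a - q i (update a i b'))) := by
    simp only [Finset.sum_mul]
    rw [sum_sum_update_swap i (fun a b => σ (update a i b) * k b (a i) * q i a)]
    simp only [update_self, update_idem, update_eq_self]
    rw [Finset.sum_comm (t := X), ← Finset.sum_sub_distrib, ← Finset.sum_subset (Finset.subset_univ X)]
    · refine Finset.sum_congr rfl fun a _ => ?_
      rw [← mul_one (σ a * q i a), ← hk1 (a i), Finset.mul_sum, ← Finset.sum_sub_distrib]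
      exact Finset.sum_congr rfl fun b _ => by ring
    · intro a _ ha
      simp [hd.2.2 a ha]
  rw [← sub_nonneg, key]
  refine Finset.sum_nonneg fun b' _ => ?_
  cases c with
  | CE =>
    -- On the fibre of a fixed recommendation `b` the factor `k b b'` is constant and can be pulled
    -- out.
    rw [← Finset.sum_fiberwise X (fun a => a i)]
    refine Finset.sum_nonneg fun b _ => ?_
    rw [Finset.sum_congr rfl (g := fun a => k b b' * (σ a * (q i a - q i (update a i b'))))
      (fun a ha => by rw [(Finset.mem_filter.1 ha).2]), ← Finset.mul_sum]
    by_cases hb : k b b' = 0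
    · simp [hb]
    · refine mul_nonneg (hk0 _ _) (sum_gain_nonneg (Finset.filter_subset _ _) i
        (fun a => update a i b') (fun a ha h0 => hmem a b' h0 ?_) (h.1 i b b'))
      rwa [(Finset.mem_filter.1 ha).2]
  | CCE =>
    -- The kernel ignores the recommendation, so any `a₀` supplies the constant factor.
    rcases X.eq_empty_or_nonempty with rfl | ⟨a₀, _⟩
    · simp
    rw [Finset.sum_congr rfl (g := fun a => k (a₀ i) b' * (σ a * (q i a - q i (update a i b'))))
      (fun a _ => by rw [hc rfl (a i) (a₀ i)]), ← Finset.mul_sum]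
    by_cases hb : k (a₀ i) b' = 0
    · simp [hb]
    · refine mul_nonneg (hk0 _ _) (sum_gain_nonneg subset_rfl i
        (fun a => update a i b') (fun a _ h0 => hmem a b' h0 ?_) (h.1 i b'))
      rwa [hc rfl (a i) (a₀ i)]

end Stage

/-! ### Bellman equations and the one-step deviation principle. -/

section Values

variable (G : ACGame ℝ)

lemma sum_cont_succ {M : Type*} [AddCommMonoid M] (k h : ℕ) (f : G.Cont (k + 1) h → M) :
    ∑ ω, f ω = ∑ a, ∑ s', ∑ ω : G.Cont k (h + 1), f (a, s', ω) := by
  refine (Fintype.sum_prod_type (f := f)).trans ?_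
  exact Finset.sum_congr rfl fun a _ => Fintype.sum_prod_type _

variable {G}

/-- Total mass one is what lets the immediate reward be split off in the Bellman equation. Branches
of probability zero contribute nothing, so feasibility at reached histories suffices. -/
lemma sum_histProb (hG : G.IsMarkovGame) (π : G.HistPolicy) : ∀ (k h : ℕ) (τ : G.History h),
    h + k ≤ G.H → G.IsFeasibleAfter π k h τ → ∑ ω, G.histProb π k h τ ω = 1
  | 0, h, τ, _, _ => by
    show ∑ ω : Unit, (1 : ℝ) = 1
    simp
  | k + 1, h, τ, hk, ⟨⟨h0, h1, h2⟩, hf⟩ => by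
    rw [sum_cont_succ, ← h1]
    refine Finset.sum_congr rfl fun a _ => ?_
    rcases (h0 a).eq_or_lt with ha | ha
    · simp [histProb, ← ha]
    have haX : a ∈ G.allowed h τ.last := by
      by_contra hX
      exact ha.ne' (h2 a hX)
    obtain ⟨p0, p1⟩ := hG h (by omega) τ.last a haX
    rw [← mul_one (π h τ a), ← p1, Finset.mul_sum]
    refine Finset.sum_congr rfl fun s' _ => ?_
    simp only [histProb]
    rw [← Finset.mul_sum]
    rcases (p0 s').eq_or_lt with hp | hp
    · simp [← hp]
    · rw [sum_histProb hG π k (h + 1) _ (by omega) (hf a s' ha hp)]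
      ring

/-- Feasibility is required only from time `h` on, because during backward induction the policy is
not yet determined earlier. -/
lemma sum_markovProb (hG : G.IsMarkovGame) (π : G.Policy) : ∀ (k h : ℕ) (s : G.State h),
    h + k ≤ G.H → (∀ h', h ≤ h' → h' < G.H → ∀ s, IsDistOn (G.allowed h' s) (π h' s)) →
      ∑ ω, G.markovProb π k h s ω = 1
  | 0, h, s, _, _ => by
    show ∑ ω : Unit, (1 : ℝ) = 1
    simp
  | k + 1, h, s, hk, hπ => by
    obtain ⟨h0, h1, h2⟩ := hπ h le_rfl (by omega) s
    rw [sum_cont_succ, ← h1]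
    refine Finset.sum_congr rfl fun a _ => ?_
    by_cases haX : a ∈ G.allowed h s
    · obtain ⟨-, p1⟩ := hG h (by omega) s a haX
      rw [← mul_one (π h s a), ← p1, Finset.mul_sum]
      refine Finset.sum_congr rfl fun s' _ => ?_
      simp only [markovProb]
      rw [← Finset.mul_sum, sum_markovProb hG π k (h + 1) s' (by omega)
        fun h' hh => hπ h' (by omega)]
      ring
    · simp [markovProb, h2 a haX]

lemma histValue_eq (hG : G.IsMarkovGame) (π : G.HistPolicy) (i : Fin G.n) {h : ℕ} (hh : h < G.H)
    (τ : G.History h) (hf : G.IsFeasibleAfter π (G.H - h) h τ) :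
    G.histValue π i h τ = ∑ a, π h τ a * (G.reward h τ.last a i +
      ∑ s', G.transProb h τ.last a s' * G.histValue π i (h + 1) (.snoc τ a s')) := by
  obtain ⟨k, hk⟩ : ∃ k, G.H = h + (k + 1) := ⟨G.H - h - 1, by omega⟩
  have e1 : G.H - h = k + 1 := by omega
  have e2 : G.H - (h + 1) = k := by omega
  unfold histValue
  rw [e1] at hf ⊢
  rw [e2, sum_cont_succ]
  obtain ⟨⟨h0, h1, h2⟩, hf⟩ := hf
  refine Finset.sum_congr rfl fun a _ => ?_
  rcases (h0 a).eq_or_lt with ha | ha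
  · simp [histProb, ← ha]
  have haX : a ∈ G.allowed h τ.last := by
    by_contra hX
    exact ha.ne' (h2 a hX)
  obtain ⟨p0, p1⟩ := hG h hh τ.last a haX
  -- The reward is spread over the next states by their total probability one, so that both sides
  -- compare state by state.
  rw [← one_mul (G.reward h τ.last a i), ← p1, Finset.sum_mul, ← Finset.sum_add_distrib,
    Finset.mul_sum]
  refine Finset.sum_congr rfl fun s' _ => ?_
  rcases (p0 s').eq_or_lt with hp | hp
  · simp [histProb, ← hp]
  have hm := sum_histProb hG π k (h + 1) _ (by omega) (hf a s' ha hp)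
  simp only [histProb, totalReward, mul_add, Finset.sum_add_distrib, mul_assoc]
  rw [← Finset.mul_sum, ← Finset.mul_sum, ← Finset.sum_mul, hm, ← Finset.mul_sum,
    ← Finset.mul_sum]
  simp only [one_mul]
  rfl

lemma markovValue_eq (hG : G.IsMarkovGame) (π : G.Policy) (i : Fin G.n) {h : ℕ} (hh : h < G.H)
    (s : G.State h) (hs : IsDistOn (G.allowed h s) (π h s))
    (hm : ∀ s', ∑ ω, G.markovProb π (G.H - (h + 1)) (h + 1) s' ω = 1) :
    G.markovValue π i h s = ∑ a, π h s a * (G.reward h s a i +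
      ∑ s', G.transProb h s a s' * G.markovValue π i (h + 1) s') := by
  obtain ⟨k, hk⟩ : ∃ k, G.H = h + (k + 1) := ⟨G.H - h - 1, by omega⟩
  have e1 : G.H - h = k + 1 := by omega
  have e2 : G.H - (h + 1) = k := by omega
  unfold markovValue
  rw [e2] at hm ⊢
  rw [e1, sum_cont_succ]
  refine Finset.sum_congr rfl fun a _ => ?_
  by_cases haX : a ∈ G.allowed h s
  · obtain ⟨p0, p1⟩ := hG h hh s a haX
    rw [← one_mul (G.reward h s a i), ← p1, Finset.sum_mul, ← Finset.sum_add_distrib,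
      Finset.mul_sum]
    refine Finset.sum_congr rfl fun s' _ => ?_
    simp only [markovProb, totalReward, mul_add, Finset.sum_add_distrib, mul_assoc]
    rw [← Finset.mul_sum, ← Finset.mul_sum, ← Finset.sum_mul, hm s', ← Finset.mul_sum,
      ← Finset.mul_sum]
    simp only [one_mul]
  · simp [markovProb, hs.2.2 a haX]

lemma markovValue_horizon (π : G.Policy) (i : Fin G.n) (s : G.State G.H) :
    G.markovValue π i G.H s = 0 := by
  unfold markovValue
  rw [Nat.sub_self]
  exact Finset.sum_eq_zero fun ω _ => by simp [totalReward]

lemma histValue_horizon (π : G.HistPolicy) (i : Fin G.n) (τ : G.History G.H) :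
    G.histValue π i G.H τ = 0 := by
  unfold histValue
  rw [Nat.sub_self]
  exact Finset.sum_eq_zero fun ω _ => by simp [totalReward]

/-- The law of the future depends only on what the policy does in the future. -/
lemma markovProb_congr {π π' : G.Policy} : ∀ (k h : ℕ) (s : G.State h) (ω : G.Cont k h),
    (∀ h', h ≤ h' → π h' = π' h') → G.markovProb π k h s ω = G.markovProb π' k h s ω
  | 0, _, _, _, _ => rfl
  | k + 1, h, s, (a, s', ω), hπ => by
    simp only [markovProb]
    rw [hπ h le_rfl, markovProb_congr k (h + 1) s' ω fun h' hh => hπ h' (by omega)]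

lemma markovValue_congr {π π' : G.Policy} (i : Fin G.n) (h : ℕ) (s : G.State h)
    (hπ : ∀ h', h ≤ h' → π h' = π' h') : G.markovValue π i h s = G.markovValue π' i h s :=
  Finset.sum_congr rfl fun ω _ => by rw [markovProb_congr _ _ _ _ hπ]

/-- The utility of an allowed joint action in the stage game. -/
noncomputable def stageValue (π : G.Policy) (h : ℕ) (s : G.State h) (i : Fin G.n)
    (a : G.JointAct) : ℝ :=
  G.reward h s a i + ∑ s', G.transProb h s a s' * G.markovValue π i (h + 1) s'

/-- Any common lower bound `M` of the utilities may stand in for `-∞`: it makes the forbidden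
actions worst, and the resulting equilibrium carries over. -/
lemma exists_isCLPSolution (c : EqConcept) {X : Finset G.JointAct} (hX : X.Nonempty)
    (q : Fin G.n → G.JointAct → ℝ) : ∃ σ, IsCLPSolution c X (restrictUtility X q) σ := by
  obtain ⟨M, hM⟩ : ∃ M, ∀ i a, M ≤ q i a := by
    obtain ⟨M, hM⟩ := (Set.finite_range fun p : Fin G.n × G.JointAct => q p.1 p.2).bddBelow
    exact ⟨M, fun i a => hM ⟨(i, a), rfl⟩⟩
  obtain ⟨σ, h1, h2⟩ := exists_isRealEq c hX (fun i a => if a ∈ X then q i a else M) (by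
    intro i a a' ha
    rw [if_neg ha]
    split_ifs
    · exact hM i a'
    · exact le_rfl)
  exact ⟨σ, isCLPSolution_of_isRealEq (fun i a ha => if_pos ha) h1 h2⟩

lemma SolvesAllStages.isFeasible {c : EqConcept} {π : G.Policy} (h : G.SolvesAllStages c π) :
    G.IsFeasible π := fun t ht s => (h t ht s).isDistOn

lemma IsHistFeasible.isFeasibleAfter {π : G.HistPolicy} (hπ : G.IsHistFeasible π) :
    ∀ (k h : ℕ) (τ : G.History h), h + k ≤ G.H → G.IsFeasibleAfter π k h τ
  | 0, _, _, _ => trivial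
  | k + 1, h, τ, hk => ⟨hπ h (by omega) τ,
      fun _ _ _ _ => hπ.isFeasibleAfter k (h + 1) _ (by omega)⟩

/-- Backward induction: on branches of positive probability the deviator's continuation value is
replaced by the larger equilibrium value. What remains is a deviation in the stage game, which is
unprofitable. -/
lemma histValue_deviate_le (hG : G.IsMarkovGame) {c : EqConcept} {π : G.Policy}
    (hπ : G.SolvesAllStages c π) (i : Fin G.n) (κ : G.Deviation i) (hκ : IsDeviation c κ) :
    ∀ (k h : ℕ) (τ : G.History h), h + k = G.H →
      G.IsFeasibleAfter (G.deviate π i κ) (G.H - h) h τ →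
      G.histValue (G.deviate π i κ) i h τ ≤ G.markovValue π i h τ.last
  | 0, h, τ, hk, _ => by
    obtain rfl : h = G.H := by omega
    rw [histValue_horizon, markovValue_horizon]
  | k + 1, h, τ, hk, hf => by
    have hh : h < G.H := by omega
    rw [histValue_eq hG _ i hh τ hf, markovValue_eq hG π i hh τ.last (hπ h hh _).isDistOn
      fun s' => sum_markovProb hG π _ _ s' (by omega) fun h' _ => hπ.isFeasible h']
    have e1 : G.H - h = G.H - (h + 1) + 1 := by omega
    rw [e1] at hf
    obtain ⟨⟨h0, h1, h2⟩, hf⟩ := hf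
    -- Feasibility of the deviation at `τ`, in the form `h2`, excludes mass outside the allowed set.
    refine le_trans ?_ (IsCLPSolution.deviation_le (q := stageValue π h τ.last)
      (hπ h hh τ.last) i (κ h τ) (fun b b' => (hκ.1 h τ b).1 b') (fun b => (hκ.1 h τ b).2) ?_ h2)
    · refine Finset.sum_le_sum fun a _ => ?_
      show G.deviate π i κ h τ a * _ ≤ G.deviate π i κ h τ a * _
      rcases (h0 a).eq_or_lt with ha | ha
      · simp [← ha]
      have haX : a ∈ G.allowed h τ.last := by
        by_contra hX
        exact ha.ne' (h2 a hX)
      refine mul_le_mul_of_nonneg_left (add_le_add le_rfl ?_) ha.le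
      refine Finset.sum_le_sum fun s' _ => ?_
      rcases ((hG h hh τ.last a haX).1 s').eq_or_lt with hp | hp
      · simp [← hp]
      · exact mul_le_mul_of_nonneg_left (histValue_deviate_le hG hπ i κ hκ k (h + 1) _
          (by omega) (hf a s' ha hp)) hp.le
    · rintro rfl
      exact hκ.2 h τ

/-- Policies that solve the constrained program of every stage game are equilibria. -/
theorem SolvesAllStages.isSubgameMPE (hG : G.IsMarkovGame) {c : EqConcept} {π : G.Policy}
    (hπ : G.SolvesAllStages c π) : G.IsSubgameMPE c π :=
  ⟨hπ.isFeasible, fun i h hh τ κ hκ => or_iff_not_imp_left.2 fun hf =>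
    histValue_deviate_le hG hπ i κ hκ (G.H - h) h τ (by omega) (not_not.1 hf)⟩

lemma IsSubgameMPE.isMPE {c : EqConcept} {π : G.Policy} (hπ : G.IsSubgameMPE c π) :
    G.IsMPE c π :=
  ⟨hπ.1, fun i h hh τ κ hκ => (hπ.2 i h hh τ κ hκ).imp_left
    fun hf hfeas => hf (hfeas.isFeasibleAfter _ _ _ (by omega))⟩

end Values

end ACGame

/-! ### Reasoning about the value, the steps and the calls of a program -/

namespace Prog

open Polynomial

variable {α β : Type}

/-- The program `p` calls the solver `m` times, its steps and the sizes of the calls are at most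
`P` at `S`, and its result satisfies `Q`. -/
structure Runs (lp : LPSolver) (S : ℕ) (P : ℕ[X]) (m : ℕ) (p : Prog ℝ α) (Q : α → Prop) :
    Prop where
  value : Q (run lp p).value
  steps : (run lp p).steps ≤ P.eval S
  length : (run lp p).calls.length = m
  sizes : ∀ L ∈ (run lp p).calls, L.2.size ≤ P.eval S

lemma run_bind (lp : LPSolver) (p : Prog ℝ α) (f : α → Prog ℝ β) :
    run lp (p >>= f) = ⟨(run lp (f (run lp p).value)).value,
      (run lp p).steps + (run lp (f (run lp p).value)).steps,
      (run lp p).calls ++ (run lp (f (run lp p).value)).calls⟩ := by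
  show run lp (Prog.bind p f) = _
  induction p with
  | ret x => simp [Prog.bind, run]
  | tick p ih => simp [Prog.bind, run, ih, Nat.add_right_comm]
  | const z k ih => simp [Prog.bind, run, ih, Nat.add_right_comm]
  | arith o x y k ih => simp [Prog.bind, run, ih, Nat.add_right_comm]
  | lt x y k ih => simp [Prog.bind, run, ih, Nat.add_right_comm]
  | call L k ih => simp [Prog.bind, run, ih, Nat.add_right_comm]

/-! ### Proof rules for instructions, sequencing and branches. -/

namespace Runs

variable {lp : LPSolver} {S : ℕ} {P P₁ P₂ : ℕ[X]} {m m₁ m₂ : ℕ}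

lemma imp {p : Prog ℝ α} {Q Q' : α → Prop} (h : Runs lp S P m p Q) (hQ : ∀ x, Q x → Q' x) :
    Runs lp S P m p Q' :=
  ⟨hQ _ h.1, h.2, h.3, h.4⟩

lemma mono {p : Prog ℝ α} {Q : α → Prop} (h : Runs lp S P₁ m p Q)
    (hP : P₁.eval S ≤ P₂.eval S) : Runs lp S P₂ m p Q :=
  ⟨h.1, h.2.trans hP, h.3, fun L hL => (h.4 L hL).trans hP⟩

lemma bind_add {p : Prog ℝ α} {Q : α → Prop} {f : α → Prog ℝ β} {R : β → Prop}
    (h₁ : Runs lp S P₁ m₁ p Q) (h₂ : ∀ x, Q x → Runs lp S P₂ m₂ (f x) R) :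
    Runs lp S (P₁ + P₂) (m₁ + m₂) (p >>= f) R := by
  have h := h₂ _ h₁.value
  constructor
  · rw [run_bind]; exact h.value
  · rw [run_bind, eval_add]; exact add_le_add h₁.steps h.steps
  · rw [run_bind, List.length_append, h₁.length, h.length]
  · intro L hL
    rw [run_bind, List.mem_append] at hL
    rw [eval_add]
    rcases hL with hL | hL
    · exact (h₁.sizes L hL).trans (Nat.le_add_right _ _)
    · exact (h.sizes L hL).trans (Nat.le_add_left _ _)

lemma bind {p : Prog ℝ α} {Q : α → Prop} {f : α → Prog ℝ β} {R : β → Prop}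
    (h₁ : Runs lp S P₁ 0 p Q) (h₂ : ∀ x, Q x → Runs lp S P₂ m (f x) R) :
    Runs lp S (P₁ + P₂) m (p >>= f) R := by
  simpa using bind_add h₁ h₂

lemma ret {x : α} {Q : α → Prop} (h : Q x) : Runs lp S 0 0 (.ret x) Q :=
  ⟨h, Nat.zero_le _, rfl, fun L hL => by simp [run] at hL⟩

lemma tick {p : Prog ℝ α} {Q : α → Prop} (h : Runs lp S P m p Q) :
    Runs lp S (P + 1) m (.tick p) Q := by
  refine ⟨h.value, ?_, h.length, fun L hL => ?_⟩
  · rw [eval_add, eval_one]; exact Nat.succ_le_succ h.steps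
  · rw [eval_add]; exact (h.sizes L hL).trans (Nat.le_add_right _ _)

lemma num {z : ℤ} : Runs lp S 1 0 (num z) (· = (z : ℝ)) :=
  ⟨rfl, by simp [Prog.num, run], rfl, fun L hL => by simp [Prog.num, run] at hL⟩

lemma add {x y : ℝ} : Runs lp S 1 0 (add x y) (· = x + y) :=
  ⟨rfl, by simp [Prog.add, run], rfl, fun L hL => by simp [Prog.add, run] at hL⟩

lemma sub {x y : ℝ} : Runs lp S 1 0 (sub x y) (· = x - y) :=
  ⟨rfl, by simp [Prog.sub, run], rfl, fun L hL => by simp [Prog.sub, run] at hL⟩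

lemma mul {x y : ℝ} : Runs lp S 1 0 (mul x y) (· = x * y) :=
  ⟨rfl, by simp [Prog.mul, run], rfl, fun L hL => by simp [Prog.mul, run] at hL⟩

lemma less {x y : ℝ} : Runs lp S 1 0 (less x y) (fun b => b = true ↔ x < y) :=
  ⟨by simp [Prog.less, run], by simp [Prog.less, run], rfl,
    fun L hL => by simp [Prog.less, run] at hL⟩

lemma run_ticks : ∀ k, run lp (ticks k) = ⟨(), k, []⟩
  | 0 => rfl
  | k + 1 => by simp [ticks, run, run_ticks k]

lemma access {k : ℕ} (hk : k ≤ S) {x : α} : Runs lp S (X + 1) 0 (access k x) (· = x) := by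
  refine ⟨?_, ?_, ?_, ?_⟩ <;> simp [Prog.access, run_bind, run_ticks, run, hk]

/-- The bounds of both branches are added so that the polynomial does not depend on the test. -/
lemma ite {b : Prop} [Decidable b] {p q : Prog ℝ α} {Q : α → Prop}
    (h₁ : b → Runs lp S P₁ m p Q) (h₂ : ¬ b → Runs lp S P₂ m q Q) :
    Runs lp S (P₁ + P₂) m (if b then p else q) Q := by
  split_ifs with h
  · exact (h₁ h).mono (by simp)
  · exact (h₂ h).mono (by simp)

/-- The continuation is examined only at the actual answer `lp.solve L`, so correctness of the
solver can be used by the caller. `P₁` pays for the size of the system, the unit for the call. -/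
lemma call_bind {N : ℕ} {L : LinSys ℝ N} (hL : L.size ≤ P₁.eval S)
    {f : Option (Fin N → ℝ) → Prog ℝ β} {Q : β → Prop}
    (h : Runs lp S P₂ m (f (lp.solve L)) Q) :
    Runs lp S (P₁ + P₂ + 1) (m + 1) (Prog.call L .ret >>= f) Q := by
  have e : run lp (Prog.call L .ret >>= f) = ⟨(run lp (f (lp.solve L))).value,
      (run lp (f (lp.solve L))).steps + 1, ⟨_, L⟩ :: (run lp (f (lp.solve L))).calls⟩ := rfl
  constructor
  · rw [e]; exact h.value
  · rw [e, eval_add, eval_add, eval_one]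
    have := h.steps
    dsimp only
    omega
  · rw [e, List.length_cons, h.length]
  · intro L' hL'
    rw [e, List.mem_cons] at hL'
    rw [eval_add, eval_add, eval_one]
    rcases hL' with rfl | hL'
    · dsimp only
      omega
    · have := h.sizes L' hL'
      omega

/-! ### Proof rules for loops. -/

lemma tabulate_nat : ∀ {N : ℕ} {f : Fin N → Prog ℝ β} {Q : Fin N → β → Prop},
    (∀ j, Runs lp S P m (f j) (Q j)) →
      Runs lp S ((N : ℕ[X]) * (P + 1)) (N * m) (tabulate N f) (fun g => ∀ j, Q j (g j))
  | 0, _, _, _ => by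
    simpa [Prog.tabulate] using ret (lp := lp) (S := S) (x := (Fin.elim0 : Fin 0 → β))
      (Q := fun _ => True) trivial
  | N + 1, f, Q, h => by
    have := tick (bind_add (h 0) fun x hx => bind_add (tabulate_nat fun j => h (Fin.succ j))
      fun g hg => ret (x := (Fin.cons x g : Fin (N + 1) → β)) (Q := fun g => ∀ j, Q j (g j))
        (Fin.cases hx hg))
    have e : m + (N * m + 0) = (N + 1) * m := by ring
    rw [e] at this
    refine this.mono (le_of_eq ?_)
    simp
    ring

/-- Trades the iteration count for the variable `X`, which makes the bound a polynomial independent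
of the game. -/
lemma nat_mul_le {N : ℕ} (hN : N ≤ S) (P : ℕ[X]) :
    ((N : ℕ[X]) * (P + 1)).eval S ≤ (X * (P + 1)).eval S := by
  simp only [eval_mul, eval_natCast, eval_X]
  exact Nat.mul_le_mul_right _ hN

lemma tabulate_calls {N : ℕ} (hN : N ≤ S) {f : Fin N → Prog ℝ β} {Q : Fin N → β → Prop}
    (h : ∀ j, Runs lp S P m (f j) (Q j)) :
    Runs lp S (X * (P + 1)) (N * m) (tabulate N f) (fun g => ∀ j, Q j (g j)) :=
  (tabulate_nat h).mono (nat_mul_le hN P)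

lemma tabulate {N : ℕ} (hN : N ≤ S) {f : Fin N → Prog ℝ β} {Q : Fin N → β → Prop}
    (h : ∀ j, Runs lp S P 0 (f j) (Q j)) :
    Runs lp S (X * (P + 1)) 0 (tabulate N f) (fun g => ∀ j, Q j (g j)) :=
  tabulate_calls hN h

/-- The invariant is indexed by the number of completed iterations; the offset `k` lets the
induction peel off the first one. -/
lemma fold_nat {I : ℕ → β → Prop} : ∀ {N k : ℕ} {x : β} {f : Fin N → β → Prog ℝ β},
    I k x → (∀ (j : Fin N) y, I (k + j) y → Runs lp S P 0 (f j y) (I (k + j + 1))) →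
      Runs lp S ((N : ℕ[X]) * (P + 1)) 0 (fold N x f) (I (k + N))
  | 0, _, _, _, hx, _ => by
    simpa [fold] using ret hx
  | N + 1, k, x, f, hx, h => by
    have := tick (bind (h 0 x hx) fun y hy =>
      fold_nat (N := N) (k := k + 1) (f := fun j => f j.succ) hy fun j y hy => by
        have := h j.succ y (by simpa [Nat.add_assoc, Nat.add_comm 1] using hy)
        simpa [Nat.add_assoc, Nat.add_comm 1] using this)
    rw [Nat.add_assoc, Nat.add_comm 1] at this
    refine this.mono (le_of_eq ?_)
    simp
    ring

/-- A loop that adds up a sum. -/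
lemma fold_sum {N : ℕ} (hN : N ≤ S) {x : ℝ} {f : Fin N → ℝ → Prog ℝ ℝ} (g : Fin N → ℝ)
    (h : ∀ j y, Runs lp S P 0 (f j y) (· = y + g j)) :
    Runs lp S (X * (P + 1)) 0 (fold N x f) (· = x + ∑ j, g j) := by
  have := fold_nat (P := P) (lp := lp) (S := S) (N := N) (k := 0) (x := x) (f := f)
    (I := fun k y => y = x + ∑ j : Fin N with j.val < k, g j) (by simp) (fun j y hy =>
      (h j y).imp fun z hz => by
        rw [hz, hy, add_assoc]
        congr 1
        have e : (Finset.univ.filter fun i : Fin N => i.val < 0 + j.val + 1) =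
            insert j (Finset.univ.filter fun i : Fin N => i.val < 0 + j.val) := by
          ext i
          simp only [Finset.mem_filter, Finset.mem_univ, true_and, Finset.mem_insert, Fin.ext_iff]
          omega
        rw [e, Finset.sum_insert (by simp), add_comm])
  refine (this.imp fun y hy => ?_).mono (nat_mul_le hN P)
  rw [hy, Finset.filter_true_of_mem fun i _ => by simp]

/-- A loop that decreases a number below finitely many bounds. -/
lemma fold_le {N : ℕ} (hN : N ≤ S) {x : ℝ} {f : Fin N → ℝ → Prog ℝ ℝ} (C : Fin N → ℝ → Prop)
    (hC : ∀ j y z, C j y → z ≤ y → C j z)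
    (h : ∀ j y, Runs lp S P 0 (f j y) (fun z => z ≤ y ∧ C j z)) :
    Runs lp S (X * (P + 1)) 0 (fold N x f) (fun z => z ≤ x ∧ ∀ j, C j z) := by
  have := fold_nat (P := P) (lp := lp) (S := S) (N := N) (k := 0) (x := x) (f := f)
    (I := fun k y => y ≤ x ∧ ∀ j : Fin N, j.val < k → C j y) (by simp) (fun j y hy =>
      (h j y).imp fun z hz => ⟨hz.1.trans hy.1, fun i hi => by
        rcases Nat.lt_succ_iff_lt_or_eq.1 hi with hi | hi
        · exact hC _ _ _ (hy.2 i hi) hz.1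
        · rw [show i = j from Fin.ext (by omega)]
          exact hz.2⟩)
  exact (this.imp fun y hy => ⟨hy.1, fun j => hy.2 j (by simp)⟩).mono (nat_mul_le hN P)

/-- All inequalities of a list hold. -/
def SatRows {M : ℕ} (l : List ((Fin M → ℝ) × ℝ)) (x : Fin M → ℝ) : Prop :=
  ∀ r ∈ l, ∑ j, r.1 j * x j ≥ r.2

lemma satRows_append {M : ℕ} {l l' : List ((Fin M → ℝ) × ℝ)} {x : Fin M → ℝ} :
    SatRows (l ++ l') x ↔ SatRows l x ∧ SatRows l' x := by
  simp only [SatRows, List.mem_append, or_imp, forall_and]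

/-- At most `Λ.eval S` inequalities, which together express the condition `C`. -/
def Describes {M : ℕ} (S : ℕ) (Λ : ℕ[X]) (C : (Fin M → ℝ) → Prop)
    (l : List ((Fin M → ℝ) × ℝ)) : Prop :=
  l.length ≤ Λ.eval S ∧ ∀ x, SatRows l x ↔ C x

lemma collect_nat {M : ℕ} {Λ : ℕ[X]} : ∀ {N : ℕ}
    {f : Fin N → Prog ℝ (List ((Fin M → ℝ) × ℝ))} {C : Fin N → (Fin M → ℝ) → Prop},
    (∀ j, Runs lp S P 0 (f j) (Describes S Λ (C j))) →
      Runs lp S ((N : ℕ[X]) * (P + 1)) 0 (collect N f)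
        (Describes S ((N : ℕ[X]) * Λ) fun x => ∀ j, C j x)
  | 0, _, _, _ => by
    simpa [collect, Describes, SatRows] using
      ret (lp := lp) (S := S) (Q := Describes S 0 fun x => True) (x := [])
        ⟨Nat.zero_le _, fun x => by simp [SatRows]⟩
  | N + 1, f, C, h => by
    have := tick (bind (h 0) fun l hl => bind (collect_nat fun j => h (Fin.succ j))
      fun l' hl' => ret (x := l ++ l')
        (Q := Describes S (((N + 1 : ℕ) : ℕ[X]) * Λ) fun x => ∀ j, C j x) ⟨by
          have h1 := hl.1
          have h2 := hl'.1
          rw [List.length_append]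
          refine (add_le_add h1 h2).trans (le_of_eq ?_)
          simp
          ring, fun x => by
          simp only [satRows_append, hl.2, hl'.2, Fin.forall_fin_succ]⟩)
    refine this.mono (le_of_eq ?_)
    simp
    ring

lemma collect {M N : ℕ} (hN : N ≤ S) {Λ : ℕ[X]}
    {f : Fin N → Prog ℝ (List ((Fin M → ℝ) × ℝ))} {C : Fin N → (Fin M → ℝ) → Prop}
    (h : ∀ j, Runs lp S P 0 (f j) (Describes S Λ (C j))) :
    Runs lp S (X * (P + 1)) 0 (collect N f) (Describes S (X * Λ) fun x => ∀ j, C j x) :=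
  ((collect_nat h).imp fun _ hl => ⟨hl.1.trans (by
    simp only [eval_mul, eval_natCast, eval_X]
    exact Nat.mul_le_mul_right _ hN), hl.2⟩).mono (nat_mul_le hN P)

end Runs

end Prog

/-! ### Analysis of the constrained solver -/

namespace ACGame

open Prog Function Polynomial

/-- The quantities that govern the running time of the stages at time `h` are at most `S`. -/
structure StageBound (G : ACGame ℝ) (h S : ℕ) : Prop where
  players : G.n ≤ S
  actions : ∀ i, G.numActions i ≤ S
  joint : G.numJoint ≤ S
  next : G.numStates (h + 1) ≤ S

/-! ### One stage: utilities, penalty, linear system, solution. -/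

section Stage

variable {lp : LPSolver} {G : ACGame ℝ} {h S : ℕ}

lemma runs_test (hS : StageBound G h S) (s : G.State h) (a : G.JointAct) :
    Runs lp S (X + 1) 0 (G.test h s a) (fun b => b = true ↔ a ∈ G.allowed h s) :=
  (Runs.access hS.players).imp fun b hb => by rw [hb, decide_eq_true_iff]

lemma runs_tabulateJoint {β : Type} (hS : StageBound G h S) {P : ℕ[X]}
    {f : G.JointAct → Prog ℝ β} {Q : G.JointAct → β → Prop}
    (hf : ∀ a, Runs lp S P 0 (f a) (Q a)) :
    Runs lp S (X * (P + 1) + 0) 0 (G.tabulateJoint f) (fun g => ∀ a, Q a (g a)) :=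
  (Runs.tabulate hS.joint fun j => hf (G.enum.symm j)).bind fun g hg =>
    Runs.ret fun a => by simpa using hg (G.enum a)

lemma runs_stageProg : ∃ P : ℕ[X], ∀ (lp : LPSolver) (G : ACGame ℝ) (h S : ℕ),
    StageBound G h S → ∀ (V : G.State (h + 1) → Fin G.n → ℝ) (s : G.State h),
    Runs lp S P 0 (G.stageProg h V s) (fun Q => ∀ i a, Q i a =
      if a ∈ G.allowed h s then
        some (G.reward h s a i + ∑ s', G.transProb h s a s' * V s' i)
      else none) := by
  -- The polynomial remains a metavariable that the rules below fill in. It is created before the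
  -- game and the solver are introduced, so it cannot depend on them.
  apply Exists.intro
  intro lp G h S hS V s
  unfold stageProg
  apply Runs.tabulate hS.players (Q := fun i (Qi : G.JointAct → Option ℝ) => ∀ a, Qi a =
    if a ∈ G.allowed h s then
      some (G.reward h s a i + ∑ s', G.transProb h s a s' * V s' i) else none)
  intro i
  apply runs_tabulateJoint hS (Q := fun a (o : Option ℝ) => o = if a ∈ G.allowed h s then
      some (G.reward h s a i + ∑ s', G.transProb h s a s' * V s' i) else none)
  intro a
  apply Runs.bind (runs_test hS s a)
  intro b hb
  apply Runs.ite
  · intro hbt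
    apply Runs.bind Runs.num
    intro z hz
    apply Runs.bind (Q := fun e => e = z + ∑ s', G.transProb h s a s' * V s' i)
    · apply Runs.fold_sum hS.next (fun s' => G.transProb h s a s' * V s' i)
      intro j y
      apply Runs.bind (Runs.access hS.players)
      rintro _ rfl
      apply Runs.bind (Runs.access (Nat.zero_le _))
      rintro _ rfl
      apply Runs.bind Runs.mul
      rintro _ rfl
      exact Runs.add
    · intro e he
      apply Runs.bind (Runs.access hS.players)
      rintro _ rfl
      apply Runs.bind Runs.add
      rintro _ rfl
      apply Runs.ret
      rw [if_pos (hb.1 hbt), he, hz]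
      simp
  · intro hbf
    apply Runs.ret
    rw [if_neg fun ha => hbf (hb.2 ha)]

lemma runs_penaltyProg : ∃ P : ℕ[X], ∀ (lp : LPSolver) (G : ACGame ℝ) (h S : ℕ),
    StageBound G h S → ∀ Q : Fin G.n → G.JointAct → Option ℝ,
    Runs lp S P 0 (G.penaltyProg Q) (fun M => ∀ i a q, Q i a = some q → M ≤ q) := by
  apply Exists.intro
  intro lp G h S hS Q
  unfold penaltyProg
  apply Runs.bind Runs.num
  intro z hz
  apply Runs.bind (Q := fun y => y ≤ z ∧ ∀ i a q, Q i a = some q → y ≤ q)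
  · apply Runs.fold_le hS.players (fun i y => ∀ a q, Q i a = some q → y ≤ q)
      (fun i y z hy hz a q hq => hz.trans (hy a q hq))
    intro i y
    apply Runs.imp
    apply Runs.fold_le hS.joint (fun j y => ∀ q, Q i (G.enum.symm j) = some q → y ≤ q)
      (fun j y z hy hz q hq => hz.trans (hy q hq))
    · intro j y
      apply Runs.bind (Runs.access hS.players)
      rintro _ rfl
      -- The budget is fixed before the case split, since both branches must share it.
      refine (?_ : Runs lp S (1 + 0) 0 _ _)
      generalize Q i (G.enum.symm j) = o
      cases o with
      | none => exact (Runs.ret ⟨le_rfl, by simp⟩).mono (by simp)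
      | some q =>
        apply Runs.bind Runs.less
        intro b hb
        cases b with
        | true => exact Runs.ret ⟨(hb.1 rfl).le, by rintro _ ⟨⟩; exact le_rfl⟩
        | false =>
          have : y ≤ q := by simpa using hb
          exact Runs.ret ⟨le_rfl, by rintro _ ⟨⟩; exact this⟩
    · exact fun y hy => ⟨hy.1, fun a q hq => hy.2 (G.enum a) q (by simpa using hq)⟩
  · intro m hm
    apply Runs.bind Runs.num
    intro o ho
    apply Runs.imp Runs.sub
    intro M hM i a q hq
    have h1 := hm.2 i a q hq
    rw [hM, ho]
    push_cast
    linarith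

lemma sum_enum (f : Fin G.numJoint → ℝ) : ∑ j, f j = ∑ a, f (G.enum a) :=
  (Equiv.sum_comp G.enum f).symm

lemma runs_devRow : ∃ P : ℕ[X], ∀ (lp : LPSolver) (G : ACGame ℝ) (h S : ℕ),
    StageBound G h S → ∀ (s : G.State h) (u : Fin G.n → G.JointAct → ℝ) (i : Fin G.n)
      (b' : G.Act i) (cond : G.JointAct → Bool),
    Runs lp S P 0 (G.devRow h s u i b' cond) (Runs.Describes S 1 fun x =>
      0 ≤ ∑ a ∈ G.allowed h s with cond a = true,
        x (G.enum a) * (u i a - u i (update a i b'))) := by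
  apply Exists.intro
  intro lp G h S hS s u i b' cond
  unfold devRow
  apply Runs.bind Runs.num
  intro z hz
  apply Runs.bind (Q := fun r => ∀ j, r j =
    if G.enum.symm j ∈ G.allowed h s ∧ cond (G.enum.symm j) = true then
      u i (G.enum.symm j) - u i (update (G.enum.symm j) i b') else 0)
  · apply Runs.tabulate hS.joint (Q := fun j y => y =
      if G.enum.symm j ∈ G.allowed h s ∧ cond (G.enum.symm j) = true then
        u i (G.enum.symm j) - u i (update (G.enum.symm j) i b') else 0)
    intro j
    apply Runs.bind (Runs.access (Nat.zero_le _))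
    rintro _ rfl
    apply Runs.bind (runs_test hS s _)
    intro b hb
    apply Runs.ite
    · intro hbt
      rw [Bool.and_eq_true, hb] at hbt
      apply Runs.bind (Runs.access hS.players)
      rintro _ rfl
      apply Runs.bind (Runs.access hS.players)
      rintro _ rfl
      rw [if_pos hbt]
      exact Runs.sub
    · intro hbf
      rw [Bool.and_eq_true, hb] at hbf
      apply Runs.ret
      rw [if_neg hbf, hz, Int.cast_zero]
  · intro r hr
    apply Runs.ret
    refine ⟨by simp, fun x => ?_⟩
    simp only [Runs.SatRows, List.mem_singleton, forall_eq, hr, hz, Int.cast_zero, ge_iff_le]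
    rw [sum_enum, ← Finset.sum_filter_add_sum_filter_not Finset.univ
      (fun a => a ∈ G.allowed h s ∧ cond a = true)]
    rw [Finset.sum_eq_zero (s := Finset.univ.filter fun a =>
      ¬ (a ∈ G.allowed h s ∧ cond a = true)), add_zero]
    · have e : (Finset.univ.filter fun a => a ∈ G.allowed h s ∧ cond a = true) =
          (G.allowed h s).filter fun a => cond a = true := by
        ext a
        simp
      rw [e]
      refine iff_of_eq (congrArg _ (Finset.sum_congr rfl fun a ha => ?_))
      rw [Equiv.symm_apply_apply, if_pos (Finset.mem_filter.1 ha), mul_comm]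
    · intro a ha
      rw [Equiv.symm_apply_apply, if_neg (Finset.mem_filter.1 ha).2, zero_mul]

lemma runs_deviationRows (c : EqConcept) : ∃ P Λ : ℕ[X], ∀ (lp : LPSolver) (G : ACGame ℝ)
    (h S : ℕ), StageBound G h S → ∀ (s : G.State h) (u : Fin G.n → G.JointAct → ℝ),
    Runs lp S P 0 (match c with
      | .CCE => collect G.n fun i => collect (G.numActions i) fun b' =>
          G.devRow h s u i b' (fun _ => true)
      | .CE => collect G.n fun i => collect (G.numActions i) fun b =>
          collect (G.numActions i) fun b' => G.devRow h s u i b' (fun a => decide (a i = b)))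
      (Runs.Describes S Λ fun x => IsRealEq c (G.allowed h s) u fun a => x (G.enum a)) := by
  obtain ⟨P, hP⟩ := runs_devRow
  cases c with
  | CE =>
    refine ⟨_, _, fun lp G h S hS s u => (Runs.collect hS.players fun i =>
      Runs.collect (hS.actions i) fun b => Runs.collect (hS.actions i) fun b' =>
        hP lp G h S hS s u i b' fun a => decide (a i = b)).imp fun l hl =>
          ⟨hl.1, fun x => (hl.2 x).trans ?_⟩⟩
    simp only [decide_eq_true_eq]
    rfl
  | CCE =>
    refine ⟨_, _, fun lp G h S hS s u => (Runs.collect hS.players fun i =>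
      Runs.collect (hS.actions i) fun b' =>
        hP lp G h S hS s u i b' fun _ => true).imp fun l hl =>
          ⟨hl.1, fun x => (hl.2 x).trans ?_⟩⟩
    simp only [Finset.filter_true]
    rfl

lemma runs_indicator (hS : StageBound G h S) (s : G.State h) (y z : ℝ) :
    Runs lp S (X * (X + 1 + (0 + 0) + 1)) 0
      (tabulate G.numJoint fun j => do
        if ← G.test h s (G.enum.symm j) then ret y else ret z)
      (fun r => ∀ j, r j = if G.enum.symm j ∈ G.allowed h s then y else z) := by
  apply Runs.tabulate hS.joint
    (Q := fun j t => t = if G.enum.symm j ∈ G.allowed h s then y else z)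
  intro j
  apply Runs.bind (runs_test hS s _)
  intro b hb
  apply Runs.ite
  · intro hbt
    exact Runs.ret (if_pos (hb.1 hbt)).symm
  · intro hbf
    exact Runs.ret (if_neg fun ha => hbf (hb.2 ha)).symm

lemma sum_indicator (s : G.State h) (y : ℝ) (r x : Fin G.numJoint → ℝ)
    (hr : ∀ j, r j = if G.enum.symm j ∈ G.allowed h s then y else 0) :
    ∑ j, r j * x j = y * ∑ a ∈ G.allowed h s, x (G.enum a) := by
  rw [sum_enum, Finset.mul_sum, ← Finset.sum_subset (Finset.subset_univ (G.allowed h s))]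
  · exact Finset.sum_congr rfl fun a ha => by rw [hr, Equiv.symm_apply_apply, if_pos ha]
  · intro a _ ha
    rw [hr, Equiv.symm_apply_apply, if_neg ha, zero_mul]

lemma runs_signRows : ∃ P Λ : ℕ[X], ∀ (lp : LPSolver) (G : ACGame ℝ)
    (h S : ℕ), StageBound G h S → ∀ (s : G.State h),
    Runs lp S P 0 (collect G.numJoint fun j => do
      if ← G.test h s (G.enum.symm j) then
        let e ← tabulate G.numJoint fun j' => if j' = j then ret (1 : ℝ) else ret 0
        ret [(e, (0 : ℝ))]
      else ret [])
      (Runs.Describes S Λ fun x => ∀ a ∈ G.allowed h s, 0 ≤ x (G.enum a)) := by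
  apply Exists.intro
  apply Exists.intro
  intro lp G h S hS s
  apply Runs.imp
  · apply Runs.collect hS.joint (Λ := 1)
      (C := fun j x => G.enum.symm j ∈ G.allowed h s → 0 ≤ x j)
    intro j
    apply Runs.bind (runs_test hS s _)
    intro b hb
    apply Runs.ite
    · intro hbt
      apply Runs.bind (Runs.tabulate hS.joint (Q := fun j' y => y = if j' = j then 1 else 0)
        fun j' => Runs.ite (fun hj => Runs.ret (if_pos hj).symm)
          fun hj => Runs.ret (if_neg hj).symm)
      intro r hr
      apply Runs.ret
      refine ⟨by simp, fun x => ?_⟩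
      simp [Runs.SatRows, hr, hb.1 hbt]
    · intro hbf
      apply Runs.ret
      exact ⟨by simp, fun x => by simp [Runs.SatRows, mt hb.2 hbf]⟩
  · refine fun l hl => ⟨hl.1, fun x => (hl.2 x).trans ?_⟩
    exact ⟨fun hx a => by simpa using hx (G.enum a), fun hx j => by
      simpa using hx (G.enum.symm j)⟩

/-- Isolates the choice of deviation rows as a program of its own, to which `runs_deviationRows`
applies. -/
lemma clpProg_eq (c : EqConcept) (s : G.State h) (u : Fin G.n → G.JointAct → ℝ) :
    G.clpProg c h s u = (do
      let z ← num 0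
      let one ← num 1
      let neg ← num (-1)
      let dev ← (match c with
        | .CCE => collect G.n fun i => collect (G.numActions i) fun b' =>
            G.devRow h s u i b' (fun _ => true)
        | .CE => collect G.n fun i => collect (G.numActions i) fun b =>
            collect (G.numActions i) fun b' => G.devRow h s u i b' (fun a => decide (a i = b)))
      let mass ← tabulate G.numJoint fun j => do
        if ← G.test h s (G.enum.symm j) then ret one else ret z
      let negMass ← tabulate G.numJoint fun j => do
        if ← G.test h s (G.enum.symm j) then ret neg else ret z
      let pos ← collect G.numJoint fun j => do
        if ← G.test h s (G.enum.symm j) then do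
          let e ← tabulate G.numJoint fun j' => if j' = j then ret one else ret z
          ret [(e, z)]
        else ret []
      ret ⟨dev ++ [(mass, one), (negMass, neg)] ++ pos⟩) := by
  cases c <;> rfl

lemma runs_clpProg (c : EqConcept) : ∃ P Λ : ℕ[X], ∀ (lp : LPSolver) (G : ACGame ℝ)
    (h S : ℕ), StageBound G h S → ∀ (s : G.State h) (u : Fin G.n → G.JointAct → ℝ),
    Runs lp S P 0 (G.clpProg c h s u) (fun L => L.size ≤ Λ.eval S ∧ ∀ x, L.Sat x ↔
      IsRealEq c (G.allowed h s) u (fun a => x (G.enum a)) ∧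
        ∑ a ∈ G.allowed h s, x (G.enum a) = 1 ∧ ∀ a ∈ G.allowed h s, 0 ≤ x (G.enum a)) := by
  obtain ⟨P₁, Λ₁, h₁⟩ := runs_deviationRows c
  obtain ⟨P₂, Λ₂, h₂⟩ := runs_signRows
  apply Exists.intro
  -- At most `X` variables, and rows of at most `X + 1` entries: deviations, two for the total mass,
  -- and signs.
  · apply Exists.intro (X + (Λ₁ + 2 + Λ₂) * (X + 1))
    intro lp G h S hS s u
    rw [clpProg_eq]
    apply Runs.bind Runs.num
    rintro _ rfl
    apply Runs.bind Runs.num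
    rintro _ rfl
    apply Runs.bind Runs.num
    rintro _ rfl
    simp only [Int.cast_zero, Int.cast_one, Int.cast_neg]
    apply Runs.bind (h₁ lp G h S hS s u)
    intro l₁ hl₁
    apply Runs.bind (runs_indicator hS s 1 0)
    intro r hr
    apply Runs.bind (runs_indicator hS s (-1) 0)
    intro r' hr'
    apply Runs.bind (h₂ lp G h S hS s)
    intro l₂ hl₂
    apply Runs.ret
    refine ⟨?_, fun x => ?_⟩
    · simp only [LinSys.size, List.length_append, List.length_cons, List.length_nil, eval_add,
        eval_mul, eval_X, eval_one, eval_ofNat]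
      gcongr
      · exact hS.joint
      · exact hl₁.1
      · norm_num
      · exact hl₂.1
      · exact hS.joint
    · show Runs.SatRows _ x ↔ _
      rw [Runs.satRows_append, Runs.satRows_append, hl₁.2, hl₂.2]
      -- The equation for the total mass is encoded as two opposite inequalities.
      have e : Runs.SatRows [(r, (1 : ℝ)), (r', -1)] x ↔
          ∑ a ∈ G.allowed h s, x (G.enum a) = 1 := by
        simp only [Runs.SatRows, List.mem_cons, List.not_mem_nil, or_false, forall_eq_or_imp,
          forall_eq, sum_indicator s 1 r x hr, sum_indicator s (-1) r' x hr']
        constructor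
        · rintro ⟨h1, h2⟩
          linarith
        · intro h1
          constructor <;> linarith
      rw [e, and_assoc]

lemma runs_solveStage (c : EqConcept) : ∃ P : ℕ[X], ∀ (lp : LPSolver), lp.IsCorrect →
    ∀ (G : ACGame ℝ) (h S : ℕ), StageBound G h S →
      ∀ (V : G.State (h + 1) → Fin G.n → ℝ) (s : G.State h), (G.allowed h s).Nonempty →
    Runs lp S P 1 (G.solveStage c h V s) (fun r =>
      IsCLPSolution c (G.allowed h s) (restrictUtility (G.allowed h s) fun i a =>
        G.reward h s a i + ∑ s', G.transProb h s a s' * V s' i) r.1 ∧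
      ∀ i, r.2 i = ∑ a, r.1 a *
        (G.reward h s a i + ∑ s', G.transProb h s a s' * V s' i)) := by
  obtain ⟨P₁, h₁⟩ := runs_stageProg
  obtain ⟨P₂, h₂⟩ := runs_penaltyProg
  obtain ⟨P₃, Λ₃, h₃⟩ := runs_clpProg c
  apply Exists.intro
  intro lp hlp G h S hS V s hX
  set q : Fin G.n → G.JointAct → ℝ := fun i a =>
    G.reward h s a i + ∑ s', G.transProb h s a s' * V s' i
  unfold solveStage
  apply Runs.bind Runs.num
  intro z hz
  apply Runs.bind (h₁ lp G h S hS V s)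
  intro Q hQ
  apply Runs.bind (h₂ lp G h S hS Q)
  intro M hM
  apply Runs.bind (Q := fun u => ∀ i a, u i a = (Q i a).getD M)
  · apply Runs.tabulate hS.players
      (Q := fun i (ui : G.JointAct → ℝ) => ∀ a, ui a = (Q i a).getD M)
    intro i
    apply runs_tabulateJoint hS (Q := fun a x => x = (Q i a).getD M)
    intro a
    apply Runs.bind (Runs.access hS.players)
    rintro _ rfl
    refine (?_ : Runs lp S 0 0 _ _)
    generalize Q i a = o
    cases o with
    | none => exact Runs.ret rfl
    | some q => exact Runs.ret rfl
  intro u hu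
  have huX : ∀ i, ∀ a ∈ G.allowed h s, u i a = q i a := fun i a ha => by
    rw [hu, hQ, if_pos ha, Option.getD_some]
  have huM : ∀ i a, a ∉ G.allowed h s → u i a = M := fun i a ha => by
    rw [hu, hQ, if_neg ha, Option.getD_none]
  have hworst : ∀ i a a', a ∉ G.allowed h s → u i a ≤ u i a' := by
    intro i a a' ha
    rw [huM i a ha]
    by_cases ha' : a' ∈ G.allowed h s
    · rw [huX i a' ha']
      exact hM i a' _ (by rw [hQ, if_pos ha'])
    · rw [huM i a' ha']
  apply Runs.bind (h₃ lp G h S hS s u)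
  rintro L ⟨hLsize, hL⟩
  apply Runs.call_bind hLsize
  -- The answer `none` would contradict the existence of an equilibrium supported on the allowed
  -- set.
  obtain ⟨x, hx, hsat⟩ : ∃ x, lp.solve L = some x ∧ L.Sat x := by
    cases hx : lp.solve L with
    | some x => exact ⟨x, rfl, (hlp L).1 x hx⟩
    | none =>
      obtain ⟨σ, ⟨h0, h1, h2⟩, hσ⟩ := exists_isRealEq c hX u hworst
      refine ((hlp L).2 hx ⟨fun j => σ (G.enum.symm j), (hL _).2 ?_⟩).elim
      simp only [Equiv.symm_apply_apply]
      refine ⟨hσ, ?_, fun a _ => h0 a⟩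
      rw [← h1]
      exact Finset.sum_subset (Finset.subset_univ _) fun a _ ha => h2 a ha
  rw [hx]
  obtain ⟨hx1, hx2, hx3⟩ := (hL x).1 hsat
  -- Variables of forbidden actions occur in no constraint with a nonzero coefficient, so the solver
  -- may return anything there; the program resets them to zero.
  apply Runs.bind (Q := fun σ => ∀ a, σ a = if a ∈ G.allowed h s then x (G.enum a) else 0)
  · apply runs_tabulateJoint hS
      (Q := fun a y => y = if a ∈ G.allowed h s then x (G.enum a) else 0)
    intro a
    apply Runs.bind (runs_test hS s a)
    intro b hb
    apply Runs.ite
    · intro hbt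
      rw [if_pos (hb.1 hbt)]
      exact Runs.access hS.players
    · intro hbf
      rw [if_neg fun ha => hbf (hb.2 ha)]
      exact Runs.ret (by rw [hz, Int.cast_zero])
  intro σ hσ
  apply Runs.bind (Q := fun v => ∀ i, v i = ∑ a, σ a * q i a)
  · apply Runs.tabulate hS.players (Q := fun i y => y = ∑ a, σ a * q i a)
    intro i
    apply Runs.imp
    · apply Runs.fold_sum hS.joint
        (fun j => σ (G.enum.symm j) * q i (G.enum.symm j))
      intro j y
      apply Runs.bind (runs_test hS s (G.enum.symm j))
      intro b hb
      apply Runs.ite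
      · intro hbt
        rw [← huX i _ (hb.1 hbt)]
        apply Runs.bind (Runs.access hS.players)
        rintro _ rfl
        apply Runs.bind (Runs.access hS.players)
        rintro _ rfl
        apply Runs.bind Runs.mul
        rintro _ rfl
        exact Runs.add
      · intro hbf
        apply Runs.ret
        rw [hσ, if_neg fun ha => hbf (hb.2 ha), zero_mul, add_zero]
    · intro y hy
      rw [hy, hz, Int.cast_zero, zero_add, sum_enum]
      simp only [Equiv.symm_apply_apply]
  intro v hv
  apply Runs.ret
  refine ⟨isCLPSolution_of_isRealEq (w := u) huX ⟨fun a => ?_, ?_, fun a ha => ?_⟩ ?_, hv⟩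
  · dsimp only
    rw [hσ]
    split_ifs with ha
    · exact hx3 a ha
    · exact le_rfl
  · dsimp only
    rw [← hx2, ← Finset.sum_subset (Finset.subset_univ (G.allowed h s))]
    · exact Finset.sum_congr rfl fun a ha => by rw [hσ, if_pos ha]
    · intro a _ ha
      rw [hσ, if_neg ha]
  · dsimp only
    rw [hσ, if_neg ha]
  · cases c with
    | CE =>
      intro i b b'
      refine (hx1 i b b').trans (le_of_eq (Finset.sum_congr rfl fun a ha => ?_))
      dsimp only
      rw [hσ, if_pos (Finset.mem_filter.1 ha).1]
    | CCE =>
      intro i b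
      refine (hx1 i b).trans (le_of_eq (Finset.sum_congr rfl fun a ha => ?_))
      dsimp only
      rw [hσ, if_pos ha]

end Stage

end ACGame

namespace ACGame

open Prog Function Polynomial

/-! ### Backward induction and the global bounds. -/

section Solver

variable {G : ACGame ℝ}

lemma numStates_le_size {h : ℕ} (hh : h ≤ G.H) : G.numStates h ≤ G.size := by
  have : G.numStates h ≤ ∑ h ∈ Finset.range (G.H + 1), G.numStates h :=
    Finset.single_le_sum (f := G.numStates) (fun _ _ => Nat.zero_le _)
      (Finset.mem_range.2 (by omega))
  unfold size
  omega

/-- The state `s` is essential: the number of joint actions is controlled only through the tables of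
a time with at least one state. -/
lemma stageBound_size {h : ℕ} (hh : h < G.H) (s : G.State h) : StageBound G h G.size where
  players := by unfold size; omega
  actions i := by
    have : G.numActions i ≤ ∑ i, G.numActions i :=
      Finset.single_le_sum (fun _ _ => Nat.zero_le _) (Finset.mem_univ i)
    unfold size
    omega
  joint := by
    have h1 : G.numStates h * G.numJoint * (1 + G.n + G.numStates (h + 1)) ≤
        ∑ h ∈ Finset.range G.H,
          G.numStates h * G.numJoint * (1 + G.n + G.numStates (h + 1)) :=
      Finset.single_le_sum
        (f := fun h => G.numStates h * G.numJoint * (1 + G.n + G.numStates (h + 1)))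
        (fun _ _ => Nat.zero_le _) (Finset.mem_range.2 hh)
    have h2 : G.numJoint ≤ G.numStates h * G.numJoint * (1 + G.n + G.numStates (h + 1)) :=
      (Nat.le_mul_of_pos_left _ s.pos).trans (Nat.le_mul_of_pos_right _ (by omega))
    unfold size
    omega
  next := numStates_le_size (by omega)

/-- What backward induction has achieved when it arrives at time `h`. -/
def IsPartialSolution (c : EqConcept) (G : ACGame ℝ) (h : ℕ)
    (r : G.Policy × (G.State h → Fin G.n → ℝ)) : Prop :=
  (∀ t, h ≤ t → t < G.H → ∀ s,
    IsCLPSolution c (G.allowed t s) (G.stageUtility r.1 t s) (r.1 t s)) ∧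
  ∀ s i, r.2 s i = G.markovValue r.1 i h s

/-- Values and stage games at time `t` look only forward, so overwriting the policy at time `h`
preserves everything established later. The computed value is then the right-hand side of the
Bellman equation. -/
lemma IsPartialSolution.step (hG : G.IsMarkovGame) {c : EqConcept} {h : ℕ} (hh : h < G.H)
    {π : G.Policy} {V : G.State (h + 1) → Fin G.n → ℝ}
    (hr : IsPartialSolution c G (h + 1) (π, V))
    {σ : G.State h → (G.JointAct → ℝ) × (Fin G.n → ℝ)}
    (hσ : ∀ s, IsCLPSolution c (G.allowed h s) (restrictUtility (G.allowed h s) fun i a =>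
        G.reward h s a i + ∑ s', G.transProb h s a s' * V s' i) (σ s).1 ∧
      ∀ i, (σ s).2 i = ∑ a, (σ s).1 a *
        (G.reward h s a i + ∑ s', G.transProb h s a s' * V s' i)) :
    IsPartialSolution c G h (update π h (fun s => (σ s).1), fun s => (σ s).2) := by
  obtain ⟨h1, h2⟩ := hr
  dsimp only at h1 h2
  simp only [h2] at hσ
  set π' : G.Policy := update π h (fun s => (σ s).1)
  have hcur : π' h = fun s => (σ s).1 := update_self ..
  have hlater : ∀ t, h + 1 ≤ t → π' t = π t := fun t ht => update_of_ne (by omega) _ _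
  have hval : ∀ t, h + 1 ≤ t → ∀ i s, G.markovValue π' i t s = G.markovValue π i t s :=
    fun t ht i s => markovValue_congr i t s fun t' ht' => hlater t' (by omega)
  have hsol : ∀ t, h ≤ t → t < G.H → ∀ s,
      IsCLPSolution c (G.allowed t s) (G.stageUtility π' t s) (π' t s) := by
    intro t ht htH s
    have hu : G.stageUtility π' t s = G.stageUtility π t s := by
      funext i a
      simp only [stageUtility, hval (t + 1) (by omega)]
    rw [hu]
    rcases ht.eq_or_lt with rfl | ht
    · rw [hcur]
      exact (hσ s).1
    · rw [hlater t ht]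
      exact h1 t ht htH s
  refine ⟨hsol, fun s i => ?_⟩
  dsimp only
  rw [markovValue_eq hG π' i hh s (hsol h le_rfl hh s).isDistOn fun s' =>
    sum_markovProb hG π' _ _ s' (by omega) fun t ht htH s => (hsol t (by omega) htH s).isDistOn,
    (hσ s).2 i, hcur]
  simp only [hval (h + 1) le_rfl]

/-- Every layer costs the same polynomial in the size of the whole game, so the bound grows linearly
in the number of layers. -/
lemma runs_backward (c : EqConcept) : ∃ P₀ P₁ : ℕ[X], ∀ (lp : LPSolver), lp.IsCorrect →
    ∀ (G : ACGame ℝ), G.IsMarkovGame → G.IsFeasibleGame → ∀ k h : ℕ, h + k = G.H →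
      Runs lp G.size (P₀ + (k : ℕ[X]) * P₁) (∑ j ∈ Finset.range k, G.numStates (h + j))
        (G.backward c k h) (IsPartialSolution c G h) := by
  obtain ⟨P, hP⟩ := runs_solveStage c
  refine ⟨1 + (X * (X * (0 + 1) + 1) + 0), X * (P + 1) + 0 + 1,
    fun lp hlp G hG hfeas k => ?_⟩
  induction k with
  | zero =>
    intro h hh
    obtain rfl : h = G.H := by omega
    rw [Finset.sum_range_zero, Nat.cast_zero, zero_mul, add_zero]
    unfold backward
    apply Runs.bind Runs.num
    intro z hz
    apply Runs.bind (Runs.tabulate (numStates_le_size le_rfl) fun s =>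
      Runs.tabulate (show G.n ≤ G.size by unfold size; omega) fun i => Runs.ret (Q := (· = z)) rfl)
    intro V hV
    apply Runs.ret
    refine ⟨fun t ht htH => absurd htH (by omega), fun s i => ?_⟩
    rw [markovValue_horizon]
    simp only [hV, hz, Int.cast_zero]
  | succ k ih =>
    intro h hh
    have hH : h < G.H := by omega
    -- The calls at time `h` are split off from those of the recursive run, which starts at `h + 1`.
    have e : ∑ j ∈ Finset.range (k + 1), G.numStates (h + j) =
        ∑ j ∈ Finset.range k, G.numStates (h + 1 + j) + (G.numStates h * 1 + 0) := by
      rw [Finset.sum_range_succ', Nat.add_zero, Nat.mul_one, Nat.add_zero]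
      exact congrArg (· + _) (Finset.sum_congr rfl fun j _ => by rw [Nat.add_assoc, Nat.add_comm 1])
    rw [e]
    unfold backward
    have hrec := ih (h + 1) (by omega)
    have hstep : ∀ r, IsPartialSolution c G (h + 1) r →
        Runs lp G.size (X * (P + 1) + 0) (G.numStates h * 1 + 0)
          (tabulate (G.numStates h) (G.solveStage c h r.2) >>= fun stage =>
            Prog.ret (update r.1 h (fun s => (stage s).1), fun s => (stage s).2))
          (IsPartialSolution c G h) := by
      rintro ⟨π, V⟩ hr
      apply Runs.bind_add (Runs.tabulate_calls (numStates_le_size hH.le) fun s =>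
        hP lp hlp G h G.size (stageBound_size hH s) V s (hfeas h hH s))
      intro σ hσ
      exact Runs.ret (hr.step hG hH hσ)
    have htot := Runs.tick (Runs.bind_add hrec hstep)
    refine htot.mono (le_of_eq (congrArg _ ?_))
    push_cast
    ring

lemma runs_constrainedSolver (c : EqConcept) : ∃ P : ℕ[X], ∀ (lp : LPSolver), lp.IsCorrect →
    ∀ (G : ACGame ℝ), G.IsMarkovGame → G.IsFeasibleGame →
      Runs lp G.size P (∑ h ∈ Finset.range G.H, G.numStates h) (G.constrainedSolver c)
        (G.SolvesAllStages c) := by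
  obtain ⟨P₀, P₁, hP⟩ := runs_backward c
  refine ⟨P₀ + X * P₁ + 0, fun lp hlp G hG hfeas => ?_⟩
  have h := (hP lp hlp G hG hfeas G.H 0 (Nat.zero_add _)).mono (P₂ := P₀ + X * P₁) (by
    simp only [eval_add, eval_mul, eval_natCast, eval_X]
    have : G.H ≤ G.size := by unfold size; omega
    gcongr
    exact_mod_cast this)
  simp only [Nat.zero_add] at h
  exact Runs.bind_add h fun r hr =>
    Runs.ret (Q := G.SolvesAllStages c) fun t ht s => hr.1 t (Nat.zero_le _) ht s

lemma eval_mono_nat (p : ℕ[X]) {a b : ℕ} (hab : a ≤ b) : p.eval a ≤ p.eval b := by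
  rw [eval_eq_sum, eval_eq_sum]
  exact Finset.sum_le_sum fun i _ => Nat.mul_le_mul_left _ (Nat.pow_le_pow_left hab i)

/-- There are at most `S` calls, on systems of size at most `P.eval S`. Polynomials with natural
coefficients are monotone, so each call costs at most `q` at that bound. -/
lemma time_le {lp : LPSolver} {q P : ℕ[X]} (hq : lp.RunsIn q) {S m : ℕ} (hm : m ≤ S) {α : Type}
    {p : Prog ℝ α} {Q : α → Prop} (h : Runs lp S P m p Q) :
    (p.run lp).time lp ≤ (P + X * q.comp P).eval S := by
  rw [eval_add, eval_mul, eval_X, eval_comp]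
  refine add_le_add h.steps ((List.sum_le_card_nsmul _ (q.eval (P.eval S)) ?_).trans ?_)
  · intro t ht
    obtain ⟨L, hL, rfl⟩ := List.mem_map.1 ht
    exact (hq L.2).trans (eval_mono_nat q (h.sizes L hL))
  · rw [List.length_map, h.length, smul_eq_mul]
    exact Nat.mul_le_mul_right _ hm

lemma sum_numStates_le_size : ∑ h ∈ Finset.range G.H, G.numStates h ≤ G.size := by
  have := Finset.sum_range_succ G.numStates G.H
  unfold size
  omega

end Solver

end ACGame

theorem mainTheorem2 (c : EqConcept) :
    -- solving the constrained program at each stage is always possible, and gives an equilibrium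
    (∀ G : ACGame ℝ, G.IsMarkovGame → G.IsFeasibleGame →
      (∀ (π : G.Policy), ∀ h < G.H, ∀ s,
        ∃ σ, ACGame.IsCLPSolution c (G.allowed h s) (G.stageUtility π h s) σ) ∧
      (∀ π : G.Policy, G.SolvesAllStages c π → G.IsMPE c π ∧ G.IsSubgameMPE c π)) ∧
    -- correctness of the algorithm with any LP solver, its own steps and its calls of the solver
    (∃ p : Polynomial ℕ, ∀ lp : LPSolver, lp.IsCorrect →
      ∀ G : ACGame ℝ, G.IsMarkovGame → G.IsFeasibleGame →
        G.SolvesAllStages c ((G.constrainedSolver c).run lp).value ∧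
        G.IsMPE c ((G.constrainedSolver c).run lp).value ∧
        G.IsSubgameMPE c ((G.constrainedSolver c).run lp).value ∧
        ((G.constrainedSolver c).run lp).steps ≤ p.eval G.size ∧
        ((G.constrainedSolver c).run lp).calls.length =
          ∑ h ∈ Finset.range G.H, G.numStates h ∧
        ∀ L ∈ ((G.constrainedSolver c).run lp).calls, L.2.size ≤ p.eval G.size) ∧
    -- polynomial running time with a polynomial-time LP solver
    (∀ q : Polynomial ℕ, ∃ p : Polynomial ℕ, ∀ lp : LPSolver, lp.IsCorrect → lp.RunsIn q →
      ∀ G : ACGame ℝ, G.IsMarkovGame → G.IsFeasibleGame →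
        ((G.constrainedSolver c).run lp).time lp ≤ p.eval G.size) := by
  obtain ⟨P, hP⟩ := ACGame.runs_constrainedSolver c
  refine ⟨fun G hG hfeas => ⟨fun π h hh s => ACGame.exists_isCLPSolution c (hfeas h hh s) _,
    fun π hπ => ⟨(hπ.isSubgameMPE hG).isMPE, hπ.isSubgameMPE hG⟩⟩,
    ⟨P, fun lp hlp G hG hfeas => ?_⟩,
    fun q => ⟨P + Polynomial.X * q.comp P, fun lp hlp hq G hG hfeas =>
      ACGame.time_le hq ACGame.sum_numStates_le_size (hP lp hlp G hG hfeas)⟩⟩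
  have h := hP lp hlp G hG hfeas
  have hsub := h.value.isSubgameMPE hG
  exact ⟨h.value, hsub.isMPE, hsub, h.steps, h.length, h.sizes⟩
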